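/- **Meshes.** Let $\Omega\subset\mathbb R^2$ be a bounded domain with regular boundary (it is enough that $\Omega$ is the interior of $\overline\Omega$). A decomposition $\mathcal T_h$ of $\Omega$ is a finite set of closed simple polygons $K$ with pairwise disjoint interiors and $\overline\Omega=\bigcup_{K\in\mathcal T_h}K$; it need not be conforming (hanging nodes are allowed). Let $h_K$ be the diameter of $K$. The set $\mathcal E_h$ of edges consists of the internal edges, i.e. the segments of positive length of the form $S_1\cap S_2$ with $S_1,S_2$ sides of two different elements, and of the boundary edges, i.e. the maximal segments of positive length contained in $S\cap\partial\Omega$ for a side $S$ of an element. Let $\hat K$ be a simple polygon and $\gamma_1,\gamma_2>0$. Assume that - $(C_0)$ every $K\in\mathcal T_h$ is the image of $\hat K$ under a bijective affine map; - $(C_1)$ every $K\in\mathcal T_h$ is star-shaped with respect to a disk of radius $\rho_K\ge\gamma_1h_K$; - $(C_2)$ for every $K\in\mathcal T_h$, any two vertices of $K$ have distance $\ge\gamma_2h_K$, and every edge $e\in\mathcal E_h$ with $e\subset\partial K$ has length $|e|\ge\gamma_2h_K$. **Spaces.** Let $\mathbb P_1$ be the polynomials of degree $\le1$. For $K\in\mathcal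 T_h$ let $V_1(K)$ be the set of all $v\in H^1(K)$ whose trace on $\partial K$ is continuous and, on each side of $K$, a polynomial of degree $\le1$, and for which $\Delta v\in\mathbb P_1(K)$. For $v\in V_1(K)$ let $\Pi^Kv\in\mathbb P_1(K)$ be the unique polynomial with $$\int_K\nabla\Pi^Kv\cdot\nabla p\,dx=\int_K\nabla v\cdot\nabla p\,dx\quad\text{for all }p\in\mathbb P_1(K),\qquad \int_{\partial K}(v-\Pi^Kv)\,ds=0 .$$ Let $W(K)=\{w\in V_1(K):\int_K(w-\Pi^Kw)\,q\,dx=0\text{ for all }q\in\mathbb P_1(K)\}$ and $W_{DG}=\{w\in L^2(\Omega): w|_K\in W(K)\text{ for all }K\in\mathcal T_h\}$, and define $\Pi w$ by $(\Pi w)|_K=\Pi^K(w|_K)$ for all $K\in\mathcal T_h$. **Norm.** For $v\in L^2(\Omega)$ with $v|_K\in H^1(K)$ for all $K\in\mathcal T_h$ put $$\|v\|_{1,DG}^2=\sum_{K\in\mathcal T_h}\bigl(\|\nabla v\|_{L^2(K)}^2+\|v\|_{L^2(K)}^2\bigr)+\sum_{e\in\mathcal E_h}\frac1{|e|}\int_e|[v]|^2\,ds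 ,$$ where $[v]=v^1n^1+v^2n^2$ on an internal edge shared by $K_1,K_2$ and $[v]=vn$ on a boundary edge; here $v^i$ is the trace of $v|_{K_i}$ and $n^i$, $n$ are the unit outward normals of the elements. **Statement.** There is a constant $c$ depending only on $\hat K,\gamma_1,\gamma_2$ (in particular not on $\mathcal T_h$, $h$ or $w$) such that, for every decomposition $\mathcal T_h$ as above, every $w\in W_{DG}$ satisfies $$\|\Pi w\|_{1,DG}\le c\,\|w\|_{1,DG}.$$ -/

import Mathlib

open MeasureTheory Filter Set
open scoped Topology ContDiff MeasureTheory

namespace DVEM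

noncomputable section

/-- The Euclidean plane. -/
abbrev Plane : Type := EuclideanSpace ℝ (Fin 2)

/-! ### Polygons -/

/-- A simple polygon: a cyclic list of at least three distinct vertices whose sides meet only in
common endpoints, together with the compact region `carrier` enclosed by the sides (the regular
closed compact set whose topological boundary is the union of the sides).  Consecutive sides are
allowed to be collinear, so that a node in the interior of a straight side may, but need not, be
listed as a vertex. -/
structure SimplePolygon where
  /-- number of vertices -/
  numV : ℕ
  /-- the cyclic list of vertices -/
  poly : Polygon Plane numV
  /-- the closed region -/
  carrier : Set Plane
  three_le : 3 ≤ numV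
  vertices_injective : Function.Injective poly.vertices
  simple : ∀ i j : Fin numV, i ≠ j →
    poly.edgeSet ℝ i ∩ poly.edgeSet ℝ j ⊆
      {poly i, poly (finRotate numV i)} ∩ {poly j, poly (finRotate numV j)}
  isCompact_carrier : IsCompact carrier
  regular_carrier : closure (interior carrier) = carrier
  frontier_carrier : frontier carrier = poly.boundary ℝ

namespace SimplePolygon

/-- The diameter `h_K`. -/
def diam (K : SimplePolygon) : ℝ := Metric.diam K.carrier

/-- Lebesgue measure on `K`. -/
def area (K : SimplePolygon) : Measure Plane := volume.restrict K.carrier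

/-- Arc length on `∂K`. -/
def arc (K : SimplePolygon) : Measure Plane := μH[1].restrict (frontier K.carrier)

/-- A unit normal of the `i`-th side (the direction of the side turned by a right angle). -/
def unitNormal (K : SimplePolygon) (i : Fin K.numV) : Plane :=
  ‖K.poly (finRotate K.numV i) - K.poly i‖⁻¹ •
    !₂[-(K.poly (finRotate K.numV i) - K.poly i) 1, (K.poly (finRotate K.numV i) - K.poly i) 0]

open Classical in
/-- The unit outward normal to `K` on the `i`-th side. -/
def outwardNormal (K : SimplePolygon) (i : Fin K.numV) : Plane :=
  if ∀ᶠ t in 𝓝[>] (0 : ℝ),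
      midpoint ℝ (K.poly i) (K.poly (finRotate K.numV i)) + t • K.unitNormal i ∉ K.carrier
  then K.unitNormal i else -K.unitNormal i

/-- `K` is star-shaped with respect to some disk of radius at least `γ * h_K`. -/
def StarShapedWrtDisk (K : SimplePolygon) (γ : ℝ) : Prop :=
  ∃ (x₀ : Plane) (ρ : ℝ), γ * K.diam ≤ ρ ∧ ∀ y ∈ Metric.ball x₀ ρ, StarConvex ℝ y K.carrier

/-! ### Sobolev functions and traces on a polygon

Functions on `K` are represented by functions on the plane; only their values on `K`, up to null
sets, matter. -/

/-- `G` is an `L²(K)` weak gradient of `v` in the interior of `K`. -/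
def HasWeakGrad (K : SimplePolygon) (v : Plane → ℝ) (G : Plane → Plane) : Prop :=
  MemLp G 2 K.area ∧
  ∀ φ : Plane → ℝ, ContDiff ℝ ∞ φ → HasCompactSupport φ → tsupport φ ⊆ interior K.carrier →
    ∫ x, v x • gradient φ x ∂K.area = -∫ x, φ x • G x ∂K.area

/-- `v ∈ H¹(K)`. -/
def MemH1 (K : SimplePolygon) (v : Plane → ℝ) : Prop :=
  MemLp v 2 K.area ∧ ∃ G, K.HasWeakGrad v G

/-- The weak gradient of `v ∈ H¹(K)` (unique almost everywhere on `K`). -/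
def weakGrad (K : SimplePolygon) (v : Plane → ℝ) : Plane → Plane :=
  Classical.epsilon (K.HasWeakGrad v)

/-- `g ∈ L²(∂K)` is the trace of `v ∈ H¹(K)`: the trace operator is the continuous extension to
`H¹(K)` of the restriction to `∂K` of functions that are smooth up to the boundary. -/
def IsTrace (K : SimplePolygon) (v g : Plane → ℝ) : Prop :=
  K.MemH1 v ∧ MemLp g 2 K.arc ∧
  ∃ φ : ℕ → Plane → ℝ, (∀ n, ContDiff ℝ ∞ (φ n)) ∧
    Tendsto (fun n => eLpNorm (fun x => φ n x - v x) 2 K.area) atTop (𝓝 0) ∧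
    Tendsto (fun n => eLpNorm (fun x => gradient (φ n) x - K.weakGrad v x) 2 K.area)
      atTop (𝓝 0) ∧
    Tendsto (fun n => eLpNorm (fun x => φ n x - g x) 2 K.arc) atTop (𝓝 0)

/-- The trace on `∂K` of `v ∈ H¹(K)` (unique almost everywhere on `∂K`). -/
def trace (K : SimplePolygon) (v : Plane → ℝ) : Plane → ℝ :=
  Classical.epsilon (K.IsTrace v)

end SimplePolygon

/-! ### The local virtual element space and the projection -/

/-- Polynomials of degree at most one on the plane. -/
def P1 : Set (Plane → ℝ) :=
  {p | ∃ (a : ℝ) (b : Plane), ∀ x, p x = a + inner ℝ b x}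

namespace SimplePolygon

/-- `B₁(∂K)`: continuous functions on `∂K` that are polynomials of degree at most one on each
side of `K`. -/
def B1 (K : SimplePolygon) : Set (Plane → ℝ) :=
  {g | ContinuousOn g (frontier K.carrier) ∧
    ∀ i : Fin K.numV, ∃ q ∈ P1, EqOn g q (K.poly.edgeSet ℝ i)}

/-- `V₁(K)`: functions in `H¹(K)` whose trace lies in `B₁(∂K)` and whose (distributional)
Laplacian is a polynomial of degree at most one. -/
def V1 (K : SimplePolygon) : Set (Plane → ℝ) :=
  {v | K.MemH1 v ∧ (∃ g ∈ K.B1, K.IsTrace v g) ∧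
    ∃ p ∈ P1, ∀ φ : Plane → ℝ, ContDiff ℝ ∞ φ → HasCompactSupport φ →
      tsupport φ ⊆ interior K.carrier →
      ∫ x, inner ℝ (K.weakGrad v x) (gradient φ x) ∂K.area = -∫ x, p x * φ x ∂K.area}

/-- The defining property of `q = Π^K v`. -/
def IsProj (K : SimplePolygon) (v q : Plane → ℝ) : Prop :=
  q ∈ P1 ∧
  (∀ p ∈ P1, ∫ x, inner ℝ (gradient q x) (gradient p x) ∂K.area =
    ∫ x, inner ℝ (K.weakGrad v x) (gradient p x) ∂K.area) ∧
  ∫ x, (K.trace v x - q x) ∂K.arc = 0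

/-- The projection `Π^K v`, the unique polynomial satisfying `IsProj`. -/
def proj (K : SimplePolygon) (v : Plane → ℝ) : Plane → ℝ :=
  Classical.epsilon (K.IsProj v)

/-- The local virtual element space `W(K)`. -/
def W (K : SimplePolygon) : Set (Plane → ℝ) :=
  {w | w ∈ K.V1 ∧ ∀ q ∈ P1, ∫ x, (w x - K.proj w x) * q x ∂K.area = 0}

end SimplePolygon

/-! ### Decompositions of a domain -/

/-- A decomposition of `Ω` into finitely many simple polygons with disjoint interiors.  It need not
be conforming: hanging nodes are allowed. -/
structure Mesh (Ω : Set Plane) where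
  /-- number of elements -/
  num : ℕ
  /-- the elements -/
  elem : Fin num → SimplePolygon
  iUnion_elem : closure Ω = ⋃ a, (elem a).carrier
  disjoint_elem : ∀ a b, a ≠ b → Disjoint (interior (elem a).carrier) (interior (elem b).carrier)

namespace Mesh

variable {Ω : Set Plane}

/-- Sides of the elements: an element together with one of its sides. -/
abbrev Side (T : Mesh Ω) : Type := Σ a : Fin T.num, Fin (T.elem a).numV

/-- The segment occupied by a side. -/
def seg (T : Mesh Ω) (s : T.Side) : Set Plane := (T.elem s.1).poly.edgeSet ℝ s.2

/-- Internal edges: the nondegenerate segments along which a side of an element meets a side of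
another element. -/
def innerEdges (T : Mesh Ω) : Set (Set Plane) :=
  {e | ∃ s t : T.Side, s.1 ≠ t.1 ∧ e = T.seg s ∩ T.seg t ∧ 0 < μH[1] e}

/-- Boundary edges: the maximal nondegenerate segments contained in a side of an element and in
`∂Ω`. -/
def boundaryEdges (T : Mesh Ω) : Set (Set Plane) :=
  {e | ∃ s : T.Side, Maximal
    (fun f : Set Plane => (∃ x y, x ≠ y ∧ f = segment ℝ x y) ∧ f ⊆ T.seg s ∩ frontier Ω) e}

/-- All edges of the decomposition. -/
def edges (T : Mesh Ω) : Set (Set Plane) := T.innerEdges ∪ T.boundaryEdges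

/-- All elements are images of one reference element under bijective affine maps. -/
def AffineEquivalentTo (T : Mesh Ω) (Khat : SimplePolygon) : Prop :=
  ∀ a, ∃ F : Plane ≃ᵃ[ℝ] Plane, F '' Khat.carrier = (T.elem a).carrier

/-- Every element is star-shaped with respect to a disk of radius at least `γ * h_K`. -/
def StarShaped (T : Mesh Ω) (γ : ℝ) : Prop :=
  ∀ a, (T.elem a).StarShapedWrtDisk γ

/-- Any two vertices of an element `K` have distance at least `γ * h_K`, and so have the two
endpoints of any edge of the decomposition that lies on `∂K` (which are vertices of `K` or
hanging nodes). -/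
def VerticesSeparated (T : Mesh Ω) (γ : ℝ) : Prop :=
  ∀ a,
    (∀ i j, i ≠ j → γ * (T.elem a).diam ≤ dist ((T.elem a).poly i) ((T.elem a).poly j)) ∧
    (∀ e ∈ T.edges, e ⊆ frontier (T.elem a).carrier →
      ENNReal.ofReal (γ * (T.elem a).diam) ≤ μH[1] e)

/-! ### The discontinuous space, jumps and the DG norm -/

/-- `H¹(𝒯_h)` -/
def H1 (T : Mesh Ω) : Set (Plane → ℝ) :=
  {v | MemLp v 2 (volume.restrict Ω) ∧ ∀ a, (T.elem a).MemH1 v}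

/-- The discontinuous virtual element space. -/
def WDG (T : Mesh Ω) : Set (Plane → ℝ) :=
  {v | MemLp v 2 (volume.restrict Ω) ∧ ∀ a, v ∈ (T.elem a).W}

open Classical in
/-- The jump `[v]` on the edge `e`: the sum of (trace of `v|_K`) times (outward normal of `K`)
over the elements `K` having a side that contains `e`.  There are two of them if `e` is internal
(so that `[v] = v¹n¹ + v²n²`), and one if `e` is a boundary edge (so that `[v] = v n`). -/
def jump (T : Mesh Ω) (v : Plane → ℝ) (e : Set Plane) (x : Plane) : Plane :=
  ∑ s : T.Side, if e ⊆ T.seg s then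
    (T.elem s.1).trace v x • (T.elem s.1).outwardNormal s.2 else 0

/-- `⟨[v],[v]⟩ = ∑ₑ |e|⁻¹ ∫ₑ |[v]|² ds` -/
def jumpSq (T : Mesh Ω) (v : Plane → ℝ) : ENNReal :=
  ∑' e : T.edges, (μH[1] (e : Set Plane))⁻¹ *
    ∫⁻ x in (e : Set Plane), ‖T.jump v e x‖ₑ ^ 2 ∂μH[1]

/-- The norm `‖v‖_{1,DG}` of `v ∈ H¹(𝒯_h)`. -/
def dgNorm (T : Mesh Ω) (v : Plane → ℝ) : ENNReal :=
  ((∑ a, (eLpNorm ((T.elem a).weakGrad v) 2 (T.elem a).area ^ 2 +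
      eLpNorm v 2 (T.elem a).area ^ 2)) + T.jumpSq v) ^ (1 / 2 : ℝ)

/-- The elementwise projection: `Πv = Π^K v` on every element `K`. -/
def proj (T : Mesh Ω) (v : Plane → ℝ) : Plane → ℝ :=
  fun x => ∑ a, (interior (T.elem a).carrier).indicator ((T.elem a).proj v) x

end Mesh

end

end DVEM

/-!
# Stability of the elementwise projection in the DG norm

On an element `K` the projection `Π^K` is an orthogonal projection for two inner products: for the
Dirichlet form by definition, and for `L²(K)` on `W(K)`, because `w - Π^K w` is orthogonal to the
affine functions.  So neither of the two volume terms of the norm increases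
(`eLpNorm_weakGrad_le`, `eLpNorm_proj_le`), and only the jumps need work.

The jump of `Πw` differs from that of `w` by one-sided traces of the error `u = Πw - w`.  As `u` has
mean value zero on `K`, the estimate `∫_S |u|² ds ≤ C h_K ∫_K |∇u|²` holds on every side `S` of `K`
(`lintegral_side_le_of_tendsto`), where `‖∇u‖ ≤ 2 ‖∇w‖`.  The factor `h_K` cancels the factor
`1/|e| ≤ 1/(γ₂ h_K)` in the norm.
The estimate combines two inequalities for smooth functions on a polygon star-shaped with respect to
a disk `B` with center `x₀` and radius `γ₁ h_K`:

* the Poincaré inequality `poincare`, by integrating the gradient along the segments from the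
  points of `B` to the points of `K`;
* the trace inequality `lintegral_side_le`, by integrating the derivative of
  `t² φ(x₀ + t (y - x₀))²` over the triangle spanned by `x₀` and the side, whose height is at
  least the radius of `B` (`radius_mul_le_abs_cross`).

The constants depend on `γ₁` only, so that the common reference element plays no role.  The
estimate passes to `u` along the smooth functions that define its trace, without any
appeal to the uniqueness of traces.

It remains to count.  Comparing areas of disjoint disks bounds the number of vertices of an element
(`numV_le`) and the number of elements through a point (`card_elem_le`), hence the number of sides
and edges through a point (`card_sides_le`, `card_edges_le`).  This controls the number of terms in
a jump and the overlap of the edges.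
-/

namespace DVEM

/-! ### Packing balls in the plane -/

/-- Comparison of areas: disjoint disks of radius `δ` inside a disk of radius `R` number at most
`(R / δ)²`. -/
theorem card_mul_sq_le_of_pairwise_disjoint_ball {ι : Type*} [Fintype ι] (c : ι → Plane)
    (p : Plane) {δ R : ℝ} (hδ : 0 ≤ δ) (hR : 0 ≤ R)
    (hd : Pairwise fun i j => Disjoint (Metric.ball (c i) δ) (Metric.ball (c j) δ))
    (hs : ∀ i, Metric.ball (c i) δ ⊆ Metric.ball p R) :
    (Fintype.card ι : ℝ) * δ ^ 2 ≤ R ^ 2 := by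
  have h1 : ∑ i, volume (Metric.ball (c i) δ) ≤ volume (Metric.ball p R) := by
    rw [← tsum_fintype (L := .unconditional _), ← measure_iUnion hd fun i => measurableSet_ball]
    exact measure_mono (iUnion_subset hs)
  have hfr : Module.finrank ℝ Plane = 2 := by simp
  simp only [Measure.addHaar_ball _ _ hδ, Measure.addHaar_ball _ _ hR, hfr, Finset.sum_const,
    Finset.card_univ, nsmul_eq_mul, ← mul_assoc] at h1
  have h0 : volume (Metric.ball (0 : Plane) 1) ≠ 0 :=
    (Metric.measure_ball_pos volume 0 one_pos).ne'
  have h2 := (ENNReal.mul_le_mul_iff_left h0 measure_ball_lt_top.ne).1 h1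
  rw [← ENNReal.ofReal_natCast, ← ENNReal.ofReal_mul (by positivity),
    ENNReal.ofReal_le_ofReal_iff (by positivity)] at h2
  exact h2

/-! ### Lengths and areas of segments and polygons -/

/-- Arc length on a segment is a rescaled Lebesgue measure in the parameter. -/
theorem hausdorffMeasure_restrict_affineSegment (a b : Plane) :
    (μH[1] : Measure Plane).restrict (affineSegment ℝ a b) =
      nndist a b • (volume.restrict (Icc (0 : ℝ) 1)).map (AffineMap.lineMap a b) := by
  have hc : Continuous (AffineMap.lineMap a b : ℝ → Plane) := AffineMap.lineMap_continuous
  ext A hA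
  rw [Measure.restrict_apply hA, Measure.smul_apply, Measure.map_apply hc.measurable hA,
    Measure.restrict_apply (hc.measurable hA), affineSegment, inter_comm A,
    ← Set.image_inter_preimage, hausdorffMeasure_lineMap_image, hausdorffMeasure_real, inter_comm]

theorem lintegral_affineSegment {f : Plane → ENNReal} (hf : Measurable f) (a b : Plane) :
    ∫⁻ x in affineSegment ℝ a b, f x ∂μH[1] =
      ENNReal.ofReal (dist a b) * ∫⁻ s in Icc (0 : ℝ) 1, f (a + s • (b - a)) := by
  have hc : Continuous (AffineMap.lineMap a b : ℝ → Plane) := AffineMap.lineMap_continuous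
  rw [hausdorffMeasure_restrict_affineSegment, lintegral_smul_measure,
    lintegral_map hf hc.measurable, ENNReal.smul_def, smul_eq_mul, ← edist_nndist, edist_dist]
  simp [AffineMap.lineMap_apply, add_comm]

theorem volume_affineSegment (a b : Plane) : volume (affineSegment ℝ a b) = 0 := by
  have hsub : affineSegment ℝ a b ⊆ (affineSpan ℝ {a, b} : AffineSubspace ℝ Plane) := by
    rintro x ⟨t, -, rfl⟩
    exact AffineMap.lineMap_mem_affineSpan_pair t a b
  refine measure_mono_null hsub (Measure.addHaar_affineSubspace _ _ fun h => ?_)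
  have h1 : (affineSpan ℝ {a, b} : AffineSubspace ℝ Plane).direction = ⊤ := by
    rw [h, AffineSubspace.direction_top]
  have h2 := (collinear_pair ℝ a b).finrank_le_one
  rw [← direction_affineSpan, h1, finrank_top] at h2
  simp at h2

theorem finRotate_ne_self {n : ℕ} (h : 2 ≤ n) (i : Fin n) : finRotate n i ≠ i := by
  obtain ⟨m, rfl⟩ := Nat.exists_eq_add_of_le' h
  rw [finRotate_apply]
  simp

namespace SimplePolygon

variable (K : SimplePolygon)

theorem isClosed_carrier : IsClosed K.carrier := K.isCompact_carrier.isClosed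

theorem frontier_subset : frontier K.carrier ⊆ K.carrier := K.isClosed_carrier.frontier_subset

theorem edgeSet_subset_frontier (i : Fin K.numV) : K.poly.edgeSet ℝ i ⊆ frontier K.carrier := by
  rw [K.frontier_carrier]
  exact subset_iUnion (fun i => K.poly.edgeSet ℝ i) i

theorem vertex_mem (i : Fin K.numV) : K.poly i ∈ K.carrier :=
  K.frontier_subset (K.edgeSet_subset_frontier i (left_mem_affineSegment ℝ _ _))

theorem vertex_finRotate_ne (i : Fin K.numV) : K.poly i ≠ K.poly (finRotate K.numV i) := fun h =>
  finRotate_ne_self (le_trans (by norm_num) K.three_le) i (K.vertices_injective h).symm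

theorem dist_le_diam {x y : Plane} (hx : x ∈ K.carrier) (hy : y ∈ K.carrier) :
    dist x y ≤ K.diam :=
  Metric.dist_le_diam_of_mem K.isCompact_carrier.isBounded hx hy

theorem diam_pos : 0 < K.diam := by
  let i : Fin K.numV := ⟨0, lt_of_lt_of_le (by norm_num) K.three_le⟩
  exact (dist_pos.2 (K.vertex_finRotate_ne i)).trans_le
    (K.dist_le_diam (K.vertex_mem _) (K.vertex_mem _))

theorem carrier_nonempty : K.carrier.Nonempty :=
  ⟨_, K.vertex_mem ⟨0, lt_of_lt_of_le (by norm_num) K.three_le⟩⟩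

theorem interior_nonempty : (interior K.carrier).Nonempty := by
  rw [← closure_nonempty_iff, K.regular_carrier]
  exact K.carrier_nonempty

theorem measurableSet_carrier : MeasurableSet K.carrier := K.isClosed_carrier.measurableSet

theorem volume_frontier : volume (frontier K.carrier) = 0 := by
  rw [K.frontier_carrier]
  exact measure_iUnion_null fun i => volume_affineSegment _ _

theorem volume_carrier_pos : 0 < volume K.carrier :=
  Measure.measure_pos_of_nonempty_interior _ K.interior_nonempty

theorem volume_carrier_ne_top : volume K.carrier ≠ ⊤ := K.isCompact_carrier.measure_lt_top.ne

instance isFiniteMeasure_area : IsFiniteMeasure K.area :=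
  ⟨by rw [area, Measure.restrict_apply_univ]; exact K.isCompact_carrier.measure_lt_top⟩

theorem ae_mem_interior : ∀ᵐ x ∂K.area, x ∈ interior K.carrier := by
  have h : ∀ᵐ x ∂K.area, x ∉ frontier K.carrier :=
    ae_restrict_of_ae (measure_eq_zero_iff_ae_notMem.1 K.volume_frontier)
  filter_upwards [h, ae_restrict_mem K.measurableSet_carrier] with x hx hxK
  by_contra hn
  exact hx ⟨subset_closure hxK, hn⟩

instance isFiniteMeasure_arc : IsFiniteMeasure K.arc := by
  refine ⟨?_⟩
  rw [arc, Measure.restrict_apply_univ, K.frontier_carrier]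
  refine (measure_iUnion_fintype_le _ _).trans_lt (ENNReal.sum_lt_top.2 fun i _ => ?_)
  rw [Polygon.edgeSet, hausdorffMeasure_affineSegment]
  exact edist_lt_top _ _

theorem arc_ne_zero : K.arc ≠ 0 := by
  intro h
  let i : Fin K.numV := ⟨0, lt_of_lt_of_le (by norm_num) K.three_le⟩
  have h1 : μH[1] (frontier K.carrier) = 0 := by
    rw [← Measure.restrict_apply_univ]
    exact congrArg (fun m : Measure Plane => m univ) h
  have h2 := measure_mono_null (K.edgeSet_subset_frontier i) h1
  rw [Polygon.edgeSet, hausdorffMeasure_affineSegment, edist_eq_zero] at h2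
  exact K.vertex_finRotate_ne i h2

/-! ### Polygons that are star-shaped with respect to a disk -/

variable {K} {x₀ : Plane} {ρ : ℝ}

theorem ball_subset_of_starConvex (hB : ∀ y ∈ Metric.ball x₀ ρ, StarConvex ℝ y K.carrier) :
    Metric.ball x₀ ρ ⊆ K.carrier := fun y hy => (hB y hy).mem K.carrier_nonempty

/-- The homothetic copies of the disk with a center in `K` stay inside `K`. -/
theorem homothety_ball_subset_interior (hB : ∀ y ∈ Metric.ball x₀ ρ, StarConvex ℝ y K.carrier)
    {y : Plane} (hy : y ∈ K.carrier) {t : ℝ} (ht : 0 < t) (ht1 : t ≤ 1) :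
    Metric.ball (y + t • (x₀ - y)) (t * ρ) ⊆ interior K.carrier := by
  refine interior_maximal (fun x hx => ?_) Metric.isOpen_ball
  have hz : y + t⁻¹ • (x - y) ∈ Metric.ball x₀ ρ := by
    rw [Metric.mem_ball, dist_eq_norm] at hx ⊢
    have h1 : x - (y + t • (x₀ - y)) = t • (y + t⁻¹ • (x - y) - x₀) := by
      have : t • t⁻¹ • (x - y) = x - y := by rw [smul_smul, mul_inv_cancel₀ ht.ne', one_smul]
      rw [smul_sub, smul_sub, smul_add, this]; abel
    rw [h1, norm_smul, Real.norm_of_nonneg ht.le] at hx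
    exact lt_of_mul_lt_mul_left hx ht.le
  have h2 := hB _ hz hy ht.le (sub_nonneg.2 ht1) (by ring)
  convert h2 using 1
  rw [smul_add, smul_smul, mul_inv_cancel₀ ht.ne', one_smul, sub_smul, one_smul]; abel

/-- The line through a side does not meet the disk: otherwise some point of the side would be
an interior point of `K`. -/
theorem side_ne_of_mem_ball (hB : ∀ y ∈ Metric.ball x₀ ρ, StarConvex ℝ y K.carrier)
    (i : Fin K.numV) {z : Plane} (hz : z ∈ Metric.ball x₀ ρ) (t : ℝ) :
    z ≠ AffineMap.lineMap (K.poly i) (K.poly (finRotate K.numV i)) t := by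
  intro hzt
  set a := K.poly i
  set b := K.poly (finRotate K.numV i)
  -- points between `z` and a point of `K` are interior
  have key : ∀ y ∈ K.carrier, ∀ r : ℝ, 0 < r → r ≤ 1 → y + r • (z - y) ∈ interior K.carrier := by
    intro y hy r hr hr1
    refine homothety_ball_subset_interior hB hy hr hr1 ?_
    rw [Metric.mem_ball, dist_eq_norm] at hz ⊢
    have : y + r • (z - y) - (y + r • (x₀ - y)) = r • (z - x₀) := by
      simp only [smul_sub]; abel
    rw [this, norm_smul, Real.norm_of_nonneg hr.le]
    exact mul_lt_mul_of_pos_left hz hr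
  have hfr : ∀ s ∈ Icc (0 : ℝ) 1, AffineMap.lineMap a b s ∉ interior K.carrier := fun s hs h =>
    (K.edgeSet_subset_frontier i ⟨s, hs, rfl⟩).2 h
  have ha : a ∈ K.carrier := K.vertex_mem _
  have hb : b ∈ K.carrier := K.vertex_mem _
  rcases le_or_gt t 0 with ht | ht
  · -- `z` lies beyond `a`, so that `a` is between `z` and `b`
    have h := key b hb (1 - t)⁻¹ (by rw [inv_pos]; linarith) (inv_le_one_of_one_le₀ (by linarith))
    refine hfr 0 (by simp) ?_
    convert h using 1
    have h1 : (1 - t) ≠ 0 := by linarith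
    rw [hzt]
    simp only [AffineMap.lineMap_apply_module']
    rw [show t • (b - a) + a - b = (1 - t) • (a - b) by
      rw [sub_smul, one_smul, ← neg_sub b a, smul_neg]; abel, smul_smul, inv_mul_cancel₀ h1]
    simp
  · -- otherwise the segment from `a` to `z` covers a part of the side
    rcases le_or_gt t 1 with h1 | h1
    · have h := key a ha 1 one_pos le_rfl
      refine hfr t ⟨ht.le, h1⟩ ?_
      convert h using 1
      rw [← hzt]; simp
    · have h := key a ha t⁻¹ (by positivity) (inv_le_one_of_one_le₀ h1.le)
      refine hfr 1 (by simp) ?_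
      convert h using 1
      rw [hzt]
      simp only [AffineMap.lineMap_apply_module']
      rw [add_sub_cancel_right, smul_smul, inv_mul_cancel₀ ht.ne', add_comm]

end SimplePolygon

/-- The determinant of two vectors of the plane. -/
noncomputable def cross (u v : Plane) : ℝ := u 0 * v 1 - u 1 * v 0

namespace SimplePolygon

variable {K : SimplePolygon} {x₀ : Plane} {ρ : ℝ}

/-- The distance from the center of the disk to the line through a side is at least the radius. -/
theorem radius_mul_le_abs_cross (hB : ∀ y ∈ Metric.ball x₀ ρ, StarConvex ℝ y K.carrier)
    (i : Fin K.numV) :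
    ρ * dist (K.poly i) (K.poly (finRotate K.numV i)) ≤
      |cross (K.poly i - x₀) (K.poly (finRotate K.numV i) - K.poly i)| := by
  by_contra! hlt
  have hd0 : K.poly (finRotate K.numV i) - K.poly i ≠ 0 :=
    sub_ne_zero.2 (K.vertex_finRotate_ne i).symm
  have hne := fun z hz t => side_ne_of_mem_ball hB i (z := z) hz t
  rw [dist_comm, dist_eq_norm] at hlt
  simp only [AffineMap.lineMap_apply_module'] at hne
  generalize K.poly i = a at *
  generalize K.poly (finRotate K.numV i) - a = d at *
  have hdp : 0 < ‖d‖ := norm_pos_iff.2 hd0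
  have hd2 : ‖d‖ ^ 2 = d 0 ^ 2 + d 1 ^ 2 := by
    rw [EuclideanSpace.norm_sq_eq, Fin.sum_univ_two]; simp
  -- the foot of the perpendicular from `x₀` to the line
  let c : ℝ := cross (a - x₀) d / ‖d‖ ^ 2
  let J : Plane := !₂[d 1, -d 0]
  have hJ : ‖J‖ = ‖d‖ := by
    rw [← sq_eq_sq₀ (norm_nonneg _) (norm_nonneg _), hd2, EuclideanSpace.norm_sq_eq,
      Fin.sum_univ_two]
    simp [J]; ring
  refine hne (x₀ + c • J) ?_ (((x₀ 0 - a 0) * d 0 + (x₀ 1 - a 1) * d 1) / ‖d‖ ^ 2) ?_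
  · rw [Metric.mem_ball, dist_eq_norm, add_sub_cancel_left, norm_smul, hJ, Real.norm_eq_abs,
      abs_div, abs_of_pos (by positivity : 0 < ‖d‖ ^ 2)]
    rw [div_mul_eq_mul_div, div_lt_iff₀ (by positivity)]
    nlinarith
  · have h2 : d 0 ^ 2 + d 1 ^ 2 ≠ 0 := by rw [← hd2]; positivity
    ext j
    fin_cases j <;>
    · simp [c, J, cross, hd2]
      field_simp
      ring

/-- If the vertices have mutual distance at least `γ` times the diameter, their number is bounded
in terms of `γ`. -/
theorem numV_le {γ : ℝ} (hγ : 0 < γ)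
    (h : ∀ i j, i ≠ j → γ * K.diam ≤ dist (K.poly i) (K.poly j)) :
    (K.numV : ℝ) ≤ (2 * (1 + γ) / γ) ^ 2 := by
  have hD := K.diam_pos
  let i₀ : Fin K.numV := ⟨0, lt_of_lt_of_le (by norm_num) K.three_le⟩
  have key := card_mul_sq_le_of_pairwise_disjoint_ball (fun i => K.poly i) (K.poly i₀)
    (δ := γ * K.diam / 2) (R := (1 + γ) * K.diam) (by positivity) (by positivity)
    (fun i j hij => Metric.ball_disjoint_ball (by linarith [h i j hij]))
    (fun i => Metric.ball_subset_ball' (by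
      nlinarith [K.dist_le_diam (K.vertex_mem i) (K.vertex_mem i₀), mul_pos hγ hD]))
  rw [Fintype.card_fin] at key
  have h2 : (2 * (1 + γ) / γ) ^ 2 = ((1 + γ) * K.diam) ^ 2 / (γ * K.diam / 2) ^ 2 := by
    field_simp
  rw [h2, le_div_iff₀ (by positivity)]
  exact key

end SimplePolygon

/-! ### Integral inequalities and changes of variables -/

/-- The Cauchy–Schwarz inequality for `f` and the constant `1`. -/
theorem enorm_integral_sq_le {α : Type*} [MeasurableSpace α] {μ : Measure α} {f : α → ℝ}
    (hf : AEStronglyMeasurable f μ) :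
    ‖∫ x, f x ∂μ‖ₑ ^ 2 ≤ μ univ * ∫⁻ x, ‖f x‖ₑ ^ 2 ∂μ := by
  have h1 := eLpNorm_le_eLpNorm_mul_rpow_measure_univ (p := 1) (q := 2) one_le_two hf
  rw [eLpNorm_one_eq_lintegral_enorm] at h1
  have h2 : eLpNorm f 2 μ ^ 2 = ∫⁻ x, ‖f x‖ₑ ^ 2 ∂μ := by
    simpa using eLpNorm_nnreal_pow_eq_lintegral (p := 2) (f := f) (μ := μ) two_ne_zero
  have h3 : ((μ univ) ^ (1 / (1 : ENNReal).toReal - 1 / (2 : ENNReal).toReal)) ^ 2 = μ univ := by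
    rw [← ENNReal.rpow_natCast, ← ENNReal.rpow_mul]
    norm_num
  calc ‖∫ x, f x ∂μ‖ₑ ^ 2 ≤ (∫⁻ x, ‖f x‖ₑ ∂μ) ^ 2 := by
        gcongr; exact enorm_integral_le_lintegral_enorm _
    _ ≤ _ := pow_le_pow_left' h1 2
    _ = _ := by rw [mul_pow, h2, h3, mul_comm]

theorem lintegral_comp_add_smul {F : Plane → ENNReal} (hF : Measurable F) (p : Plane) {r : ℝ}
    (hr : r ≠ 0) :
    ∫⁻ x, F (p + r • x) = ENNReal.ofReal (r ^ 2)⁻¹ * ∫⁻ x, F x := by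
  have h1 : ∫⁻ x, F (p + r • x) = ∫⁻ x, F (p + x) ∂(volume : Measure Plane).map (r • ·) :=
    (lintegral_map (f := fun x => F (p + x)) (by fun_prop) (by fun_prop)).symm
  rw [h1, Measure.map_addHaar_smul _ hr, lintegral_smul_measure, lintegral_add_left_eq_self]
  simp

theorem lintegral_comp_mul_left {F : ℝ → ENNReal} (hF : Measurable F) {r : ℝ} (hr : 0 < r) :
    ENNReal.ofReal r * ∫⁻ x, F (r * x) = ∫⁻ x, F x := by
  have h1 : ∫⁻ x, F (r * x) = ∫⁻ x, F x ∂(volume : Measure ℝ).map (r * ·) :=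
    (lintegral_map hF (by fun_prop)).symm
  rw [h1, Real.map_volume_mul_left hr.ne', lintegral_smul_measure, smul_eq_mul, ← mul_assoc,
    ← ENNReal.ofReal_mul hr.le, abs_of_pos (by positivity), mul_inv_cancel₀ hr.ne']
  simp

/-- Integration in the oblique coordinates `(t, r) ↦ p + t u + r v`. -/
theorem lintegral_oblique {F : Plane → ENNReal} (hF : Measurable F) (p u v : Plane)
    (h : cross u v ≠ 0) :
    ENNReal.ofReal |cross u v| * ∫⁻ t : ℝ, ∫⁻ r : ℝ, F (p + t • u + r • v) = ∫⁻ x, F x := by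
  let b := (EuclideanSpace.basisFun (Fin 2) ℝ).toBasis
  let M : Matrix (Fin 2) (Fin 2) ℝ := !![u 0, v 0; u 1, v 1]
  let L : Plane →ₗ[ℝ] Plane := Matrix.toLin b b M
  have hdet : LinearMap.det L = cross u v := by
    rw [LinearMap.det_toLin, Matrix.det_fin_two_of, cross]; ring
  have hL : ∀ x : Plane, L x = x 0 • u + x 1 • v := by
    intro x
    ext j
    fin_cases j <;> simp [L, b, Matrix.toLin_apply, Matrix.mulVec, M, dotProduct,
      Fin.sum_univ_two, mul_comm]
  have hLc : Continuous L := L.continuous_of_finiteDimensional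
  let e : Plane ≃ᵐ ℝ × ℝ :=
    (MeasurableEquiv.toLp 2 (Fin 2 → ℝ)).symm.trans MeasurableEquiv.finTwoArrow
  have he : MeasurePreserving e :=
    (volume_preserving_finTwoArrow ℝ).comp
      (EuclideanSpace.volume_preserving_symm_measurableEquiv_toLp (Fin 2))
  have h1 : ∫⁻ t : ℝ, ∫⁻ r : ℝ, F (p + t • u + r • v) = ∫⁻ x : Plane, F (p + L x) := by
    have hm : Measurable fun z : ℝ × ℝ => F (p + z.1 • u + z.2 • v) := hF.comp (by fun_prop)
    rw [← lintegral_prod (fun z : ℝ × ℝ => F (p + z.1 • u + z.2 • v)) hm.aemeasurable,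
      ← Measure.volume_eq_prod, ← he.lintegral_comp hm]
    refine lintegral_congr fun x => ?_
    rw [hL, ← add_assoc]
    rfl
  have h2 : ∫⁻ x : Plane, F (p + L x) = ∫⁻ x, F (p + x) ∂(volume : Measure Plane).map L :=
    (lintegral_map (f := fun x => F (p + x)) (by fun_prop) hLc.measurable).symm
  rw [h1, h2, Measure.map_linearMap_addHaar_eq_smul_addHaar _ (hdet ▸ h), lintegral_smul_measure,
    lintegral_add_left_eq_self, hdet, smul_eq_mul, ← mul_assoc, ← ENNReal.ofReal_mul (abs_nonneg _),
    ← abs_mul, mul_inv_cancel₀ h]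
  simp

/-- The integral over the triangle with apex `x₀` and base `[a, b]`, in the coordinates
`(s, t) ↦ x₀ + t (a + s (b - a) - x₀)` with Jacobian `t |det|`, is at most that over the plane. -/
theorem lintegral_triangle_le {F : Plane → ENNReal} (hF : Measurable F) (x₀ a b : Plane)
    (h : cross (a - x₀) (b - a) ≠ 0) :
    ENNReal.ofReal |cross (a - x₀) (b - a)| * ∫⁻ s in Icc (0 : ℝ) 1, ∫⁻ t in Icc (0 : ℝ) 1,
      ENNReal.ofReal t * F (x₀ + t • (a + s • (b - a) - x₀)) ≤ ∫⁻ x, F x := by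
  rw [← lintegral_oblique hF x₀ _ _ h]
  refine mul_le_mul_right ?_ _
  rw [lintegral_lintegral_swap (by
    refine Measurable.aemeasurable ?_
    exact (by fun_prop : Measurable fun z : ℝ × ℝ => ENNReal.ofReal z.2).mul
      (hF.comp (by fun_prop)))]
  calc _ ≤ ∫⁻ t in Icc (0 : ℝ) 1, ∫⁻ r : ℝ, F (x₀ + t • (a - x₀) + r • (b - a)) := ?_
    _ ≤ _ := setLIntegral_le_lintegral _ _
  have h0 : ∀ᵐ t ∂(volume : Measure ℝ).restrict (Icc 0 1), t ≠ 0 :=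
    ae_restrict_of_ae (by simp [ae_iff])
  refine lintegral_mono_ae ?_
  filter_upwards [h0, ae_restrict_mem measurableSet_Icc] with t ht0 ht
  have htp : 0 < t := lt_of_le_of_ne ht.1 ht0.symm
  rw [← lintegral_comp_mul_left (F := fun r => F (x₀ + t • (a - x₀) + r • (b - a)))
    (by fun_prop) htp, lintegral_const_mul _ (by fun_prop)]
  refine mul_le_mul_right ?_ _
  refine (setLIntegral_le_lintegral _ _).trans_eq (lintegral_congr fun s => ?_)
  congr 1
  rw [mul_smul, add_assoc, ← smul_add]
  congr 2
  abel

/-! ### The Poincaré and trace inequalities for smooth functions -/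

theorem norm_gradient (φ : Plane → ℝ) (x : Plane) : ‖gradient φ x‖ = ‖fderiv ℝ φ x‖ := by
  rw [gradient, LinearIsometryEquiv.norm_map]

theorem continuous_gradient {φ : Plane → ℝ} (hφ : ContDiff ℝ ∞ φ) : Continuous (gradient φ) :=
  (InnerProductSpace.toDual ℝ Plane).symm.continuous.comp (hφ.continuous_fderiv (by simp))

theorem hasDerivAt_comp_segment {φ : Plane → ℝ} (hφ : ContDiff ℝ ∞ φ) (y d : Plane) (t : ℝ) :
    HasDerivAt (fun t : ℝ => φ (y + t • d)) (fderiv ℝ φ (y + t • d) d) t := by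
  have h1 : HasDerivAt (fun t : ℝ => y + t • d) d t := by
    simpa using ((hasDerivAt_id t).smul_const d).const_add y
  exact ((hφ.differentiable (by simp)) (y + t • d)).hasFDerivAt.comp_hasDerivAt t h1

namespace SimplePolygon

variable {K : SimplePolygon} {x₀ : Plane} {ρ : ℝ}

/-- The gradient is integrated along the segment from `y` to `x`. Its extension by zero outside
`K` makes the integrand a function on the whole plane, as the changes of variables need. -/
theorem enorm_sub_sq_le {φ : Plane → ℝ} (hφ : ContDiff ℝ ∞ φ)
    {x y : Plane} (hx : x ∈ K.carrier) (hy : y ∈ K.carrier) (hs : StarConvex ℝ y K.carrier) :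
    ‖φ x - φ y‖ₑ ^ 2 ≤ ENNReal.ofReal (K.diam ^ 2) * ∫⁻ t in Icc (0 : ℝ) 1,
      K.carrier.indicator (fun z => ‖gradient φ z‖ₑ ^ 2) (y + t • (x - y)) := by
  have hc : Continuous fun t : ℝ => fderiv ℝ φ (y + t • (x - y)) (x - y) :=
    ((hφ.continuous_fderiv (by simp)).comp (by fun_prop)).clm_apply continuous_const
  have h1 : ∫ t in Icc (0 : ℝ) 1, fderiv ℝ φ (y + t • (x - y)) (x - y) = φ x - φ y := by
    rw [integral_Icc_eq_integral_Ioc, ← intervalIntegral.integral_of_le zero_le_one,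
      intervalIntegral.integral_eq_sub_of_hasDerivAt
        (fun t _ => hasDerivAt_comp_segment hφ y (x - y) t) (hc.intervalIntegrable _ _)]
    simp
  rw [← h1]
  refine (enorm_integral_sq_le hc.aestronglyMeasurable).trans ?_
  rw [Measure.restrict_apply_univ, Real.volume_Icc, sub_zero, ENNReal.ofReal_one, one_mul,
    ← lintegral_const_mul' _ _ ENNReal.ofReal_ne_top]
  refine setLIntegral_mono' measurableSet_Icc fun t ht => ?_
  have hm : y + t • (x - y) ∈ K.carrier := by
    have := hs hx (sub_nonneg.2 ht.2) ht.1 (by ring)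
    convert this using 1
    rw [smul_sub, sub_smul, one_smul]; abel
  rw [indicator_of_mem hm, ← ofReal_norm, ← ofReal_norm, ← ENNReal.ofReal_pow (norm_nonneg _),
    ← ENNReal.ofReal_pow (norm_nonneg _), ← ENNReal.ofReal_mul (by positivity), norm_gradient]
  refine ENNReal.ofReal_le_ofReal ?_
  rw [← mul_pow]
  refine pow_le_pow_left₀ (norm_nonneg _) ?_ 2
  refine (ContinuousLinearMap.le_opNorm _ _).trans ?_
  rw [mul_comm]
  gcongr
  rw [← dist_eq_norm]
  exact K.dist_le_diam hx hy

/-- Integrating differences of values over pairs of points of the disk and of `K`.  The segments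
between them stay in `K`.  The point at parameter `t` of such a segment depends on the endpoint in
`K` by a homothety of ratio `t`, and on the endpoint in the disk by one of ratio `1 - t`; one of
the two ratios is at least `1/2`. -/
theorem lintegral_lintegral_enorm_sub_sq_le {φ : Plane → ℝ} (hφ : ContDiff ℝ ∞ φ)
    (hB : ∀ y ∈ Metric.ball x₀ ρ, StarConvex ℝ y K.carrier) :
    ∫⁻ y in Metric.ball x₀ ρ, ∫⁻ x in K.carrier, ‖φ x - φ y‖ₑ ^ 2 ≤
      ENNReal.ofReal (4 * K.diam ^ 2) * volume K.carrier *
        ∫⁻ x in K.carrier, ‖gradient φ x‖ₑ ^ 2 := by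
  set F : Plane → ENNReal := K.carrier.indicator (fun z => ‖gradient φ z‖ₑ ^ 2) with hF
  have hFm : Measurable F := by
    refine Measurable.indicator ?_ K.measurableSet_carrier
    exact ((continuous_gradient hφ).enorm.measurable).pow_const 2
  have hFI : ∫⁻ x in K.carrier, ‖gradient φ x‖ₑ ^ 2 = ∫⁻ x, F x :=
    (lintegral_indicator K.measurableSet_carrier _).symm
  have hBK : Metric.ball x₀ ρ ⊆ K.carrier := ball_subset_of_starConvex hB
  have hslice : ∀ t ∈ Icc (0 : ℝ) 1,
      ∫⁻ y in Metric.ball x₀ ρ, ∫⁻ x in K.carrier, F (y + t • (x - y)) ≤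
        4 * volume K.carrier * ∫⁻ x, F x := by
    intro t ht
    have hrw : ∀ x y : Plane, y + t • (x - y) = (1 - t) • y + t • x := fun x y => by
      rw [smul_sub, sub_smul, one_smul]; abel
    have hquarter : ∀ r : ℝ, 1 / 2 ≤ r → ENNReal.ofReal (r ^ 2)⁻¹ ≤ 4 := by
      intro r hr
      rw [show (4 : ENNReal) = ENNReal.ofReal 4 by norm_num]
      refine ENNReal.ofReal_le_ofReal (inv_le_of_inv_le₀ (by norm_num) ?_)
      nlinarith
    simp only [hrw]
    rcases le_total (1 / 2) t with h | h
    · calc _ ≤ ∫⁻ y in Metric.ball x₀ ρ, 4 * ∫⁻ x, F x := by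
            refine lintegral_mono fun y => ?_
            refine (setLIntegral_le_lintegral _ _).trans ?_
            rw [lintegral_comp_add_smul hFm _ (by linarith)]
            gcongr
            exact hquarter t h
        _ ≤ _ := by
            rw [setLIntegral_const, mul_right_comm]
            gcongr
    · rw [lintegral_lintegral_swap (by
        refine (hFm.comp (by fun_prop : Measurable fun z : Plane × Plane =>
          (1 - t) • z.1 + t • z.2)).aemeasurable)]
      calc _ ≤ ∫⁻ x in K.carrier, 4 * ∫⁻ x, F x := by
            refine lintegral_mono fun x => ?_
            refine (setLIntegral_le_lintegral _ _).trans ?_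
            simp only [add_comm _ (t • x)]
            rw [lintegral_comp_add_smul hFm _ (by linarith)]
            gcongr
            exact hquarter (1 - t) (by linarith)
        _ = _ := by rw [setLIntegral_const, mul_right_comm]
  calc ∫⁻ y in Metric.ball x₀ ρ, ∫⁻ x in K.carrier, ‖φ x - φ y‖ₑ ^ 2
      ≤ ∫⁻ y in Metric.ball x₀ ρ, ∫⁻ x in K.carrier, ENNReal.ofReal (K.diam ^ 2) *
          ∫⁻ t in Icc (0 : ℝ) 1, F (y + t • (x - y)) := by
        refine setLIntegral_mono' measurableSet_ball fun y hy => ?_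
        refine setLIntegral_mono' K.measurableSet_carrier fun x hx => ?_
        exact enorm_sub_sq_le hφ hx (hBK hy) (hB y hy)
    _ = ENNReal.ofReal (K.diam ^ 2) * ∫⁻ t in Icc (0 : ℝ) 1, ∫⁻ y in Metric.ball x₀ ρ,
          ∫⁻ x in K.carrier, F (y + t • (x - y)) := by
        simp_rw [lintegral_const_mul' _ _ ENNReal.ofReal_ne_top]
        congr 1
        have h1 : ∀ y : Plane, ∫⁻ x in K.carrier, ∫⁻ t in Icc (0 : ℝ) 1, F (y + t • (x - y)) =
            ∫⁻ t in Icc (0 : ℝ) 1, ∫⁻ x in K.carrier, F (y + t • (x - y)) := fun y =>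
          lintegral_lintegral_swap (hFm.comp (by fun_prop : Measurable fun z : Plane × ℝ =>
            y + z.2 • (z.1 - y))).aemeasurable
        simp_rw [h1]
        refine lintegral_lintegral_swap (Measurable.aemeasurable ?_)
        exact Measurable.lintegral_prod_right' (hFm.comp
          (by fun_prop : Measurable fun z : (Plane × ℝ) × Plane => z.1.1 + z.1.2 • (z.2 - z.1.1)))
    _ ≤ ENNReal.ofReal (K.diam ^ 2) * ∫⁻ t in Icc (0 : ℝ) 1,
          4 * volume K.carrier * ∫⁻ x, F x := by
        gcongr 1
        exact setLIntegral_mono' measurableSet_Icc hslice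
    _ = _ := by
        rw [setLIntegral_const, Real.volume_Icc, hFI, ENNReal.ofReal_mul (by norm_num)]
        simp
        ring

/-- Among all constants, the mean value is closest in the mean square. -/
theorem lintegral_enorm_sq_le_mean_add {φ : Plane → ℝ} (hφ : Continuous φ) (c : ℝ) :
    ∫⁻ x in K.carrier, ‖φ x‖ₑ ^ 2 ≤
      (volume K.carrier)⁻¹ * ‖∫ x in K.carrier, φ x‖ₑ ^ 2 +
        ∫⁻ x in K.carrier, ‖φ x - c‖ₑ ^ 2 := by
  have hint : ∀ f : Plane → ℝ, Continuous f → IntegrableOn f K.carrier := fun f hf =>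
    hf.continuousOn.integrableOn_compact K.isCompact_carrier
  have hconv : ∀ f : Plane → ℝ, Continuous f →
      ∫⁻ x in K.carrier, ‖f x‖ₑ ^ 2 = ENNReal.ofReal (∫ x in K.carrier, f x ^ 2) := by
    intro f hf
    rw [ofReal_integral_eq_lintegral_ofReal (hint (fun x => f x ^ 2) (hf.pow 2))
      (Eventually.of_forall fun x => sq_nonneg _)]
    refine lintegral_congr fun x => ?_
    rw [← ofReal_norm, ← ENNReal.ofReal_pow (norm_nonneg _), Real.norm_eq_abs, sq_abs]
  set V := (volume K.carrier).toReal with hV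
  have hVp : 0 < V := ENNReal.toReal_pos K.volume_carrier_pos.ne' K.volume_carrier_ne_top
  have hVe : volume K.carrier = ENNReal.ofReal V :=
    (ENNReal.ofReal_toReal K.volume_carrier_ne_top).symm
  have hexp : ∫ x in K.carrier, (φ x - c) ^ 2 =
      (∫ x in K.carrier, φ x ^ 2) - 2 * c * (∫ x in K.carrier, φ x) + c ^ 2 * V := by
    have : ∀ x, (φ x - c) ^ 2 = φ x ^ 2 - 2 * c * φ x + c ^ 2 := fun x => by ring
    simp_rw [this]
    have i1 : IntegrableOn (fun x => φ x ^ 2) K.carrier := hint _ (hφ.pow 2)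
    have i2 : IntegrableOn (fun x => 2 * c * φ x) K.carrier := hint _ (hφ.const_mul _)
    have i3 : IntegrableOn (fun x => φ x ^ 2 - 2 * c * φ x) K.carrier := i1.sub i2
    rw [integral_add i3 (hint (fun _ => c ^ 2) continuous_const),
      integral_sub i1 i2, integral_const_mul,
      setIntegral_const, measureReal_def, smul_eq_mul, mul_comm V]
  rw [hconv φ hφ, hconv (fun x => φ x - c) (by fun_prop), hVe, ← ofReal_norm,
    ← ENNReal.ofReal_pow (norm_nonneg _), ← ENNReal.ofReal_inv_of_pos hVp,
    ← ENNReal.ofReal_mul (by positivity), ← ENNReal.ofReal_add (by positivity)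
      (integral_nonneg fun x => sq_nonneg _)]
  refine ENNReal.ofReal_le_ofReal ?_
  rw [hexp, Real.norm_eq_abs, sq_abs]
  have h1 : V⁻¹ * (∫ x in K.carrier, φ x) ^ 2 - 2 * c * (∫ x in K.carrier, φ x) + c ^ 2 * V =
      V⁻¹ * ((∫ x in K.carrier, φ x) - c * V) ^ 2 := by
    field_simp
    ring
  have h2 : 0 ≤ V⁻¹ * ((∫ x in K.carrier, φ x) - c * V) ^ 2 := by positivity
  linarith

theorem volume_carrier_le (hB : ∀ y ∈ Metric.ball x₀ ρ, StarConvex ℝ y K.carrier) (hρ : 0 < ρ) :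
    volume K.carrier ≤ ENNReal.ofReal ((K.diam / ρ) ^ 2) * volume (Metric.ball x₀ ρ) := by
  have hx₀ : x₀ ∈ K.carrier := ball_subset_of_starConvex hB (Metric.mem_ball_self hρ)
  have hsub : K.carrier ⊆ Metric.closedBall x₀ K.diam := fun y hy => K.dist_le_diam hy hx₀
  refine (measure_mono hsub).trans_eq ?_
  have hfr : Module.finrank ℝ Plane = 2 := by simp
  rw [Measure.addHaar_closedBall _ _ K.diam_pos.le, Measure.addHaar_ball _ _ hρ.le, hfr,
    ← mul_assoc, ← ENNReal.ofReal_mul (by positivity)]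
  congr 2
  field_simp

/-- The Poincaré inequality for polygons that are star-shaped with respect to a disk. -/
theorem poincare {φ : Plane → ℝ} (hφ : ContDiff ℝ ∞ φ)
    (hB : ∀ y ∈ Metric.ball x₀ ρ, StarConvex ℝ y K.carrier) (hρ : 0 < ρ) :
    ∫⁻ x in K.carrier, ‖φ x‖ₑ ^ 2 ≤
      (volume K.carrier)⁻¹ * ‖∫ x in K.carrier, φ x‖ₑ ^ 2 +
        ENNReal.ofReal (4 * K.diam ^ 2 * (K.diam / ρ) ^ 2) *
          ∫⁻ x in K.carrier, ‖gradient φ x‖ₑ ^ 2 := by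
  set B := Metric.ball x₀ ρ
  have hB0 : volume B ≠ 0 := (Metric.measure_ball_pos volume x₀ hρ).ne'
  have hBt : volume B ≠ ⊤ := measure_ball_lt_top.ne
  set m := (volume K.carrier)⁻¹ * ‖∫ x in K.carrier, φ x‖ₑ ^ 2
  set D := ∫⁻ x in K.carrier, ‖gradient φ x‖ₑ ^ 2
  rw [← ENNReal.mul_le_mul_iff_right hB0 hBt]
  calc volume B * ∫⁻ x in K.carrier, ‖φ x‖ₑ ^ 2
      = ∫⁻ y in B, ∫⁻ x in K.carrier, ‖φ x‖ₑ ^ 2 := by rw [setLIntegral_const, mul_comm]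
    _ ≤ ∫⁻ y in B, (m + ∫⁻ x in K.carrier, ‖φ x - φ y‖ₑ ^ 2) :=
        lintegral_mono fun y => lintegral_enorm_sq_le_mean_add hφ.continuous (φ y)
    _ = volume B * m + ∫⁻ y in B, ∫⁻ x in K.carrier, ‖φ x - φ y‖ₑ ^ 2 := by
        rw [lintegral_add_left measurable_const, setLIntegral_const, mul_comm]
    _ ≤ volume B * m + ENNReal.ofReal (4 * K.diam ^ 2) *
          (ENNReal.ofReal ((K.diam / ρ) ^ 2) * volume B) * D := by
        gcongr
        refine (lintegral_lintegral_enorm_sub_sq_le hφ hB).trans ?_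
        gcongr
        exact volume_carrier_le hB hρ
    _ = _ := by
        rw [ENNReal.ofReal_mul (by positivity : 0 ≤ 4 * K.diam ^ 2)]
        ring

/-- The bound comes from integrating the derivative of `t² φ(x₀ + t (y - x₀))²` over `[0, 1]`. The
factor `t` that is left in the integrand is the Jacobian of the coordinates of the triangle. -/
theorem enorm_sq_le_lintegral {φ : Plane → ℝ} (hφ : ContDiff ℝ ∞ φ) {y : Plane}
    (hy : y ∈ K.carrier) (hx₀ : x₀ ∈ K.carrier) (hs : StarConvex ℝ x₀ K.carrier) :
    ‖φ y‖ₑ ^ 2 ≤ ∫⁻ t in Icc (0 : ℝ) 1, ENNReal.ofReal t * K.carrier.indicator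
      (fun z => 3 * ‖φ z‖ₑ ^ 2 + ENNReal.ofReal (K.diam ^ 2) * ‖gradient φ z‖ₑ ^ 2)
        (x₀ + t • (y - x₀)) := by
  set d := y - x₀ with hd
  have hdn : ‖d‖ ≤ K.diam := by rw [hd, ← dist_eq_norm]; exact K.dist_le_diam hy hx₀
  set ψ' : ℝ → ℝ := fun t => 2 * t * φ (x₀ + t • d) ^ 2 +
    t ^ 2 * (2 * φ (x₀ + t • d) * fderiv ℝ φ (x₀ + t • d) d) with hψ'
  have hder : ∀ t : ℝ, HasDerivAt (fun t : ℝ => t ^ 2 * φ (x₀ + t • d) ^ 2) (ψ' t) t := by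
    intro t
    have := (hasDerivAt_pow 2 t).mul ((hasDerivAt_comp_segment hφ x₀ d t).pow 2)
    exact this.congr_deriv (by simp [hψ'])
  have hφc : Continuous fun t : ℝ => φ (x₀ + t • d) := hφ.continuous.comp (by fun_prop)
  have hDc : Continuous fun t : ℝ => fderiv ℝ φ (x₀ + t • d) d :=
    ((hφ.continuous_fderiv (by simp)).comp (by fun_prop)).clm_apply continuous_const
  have hc : Continuous ψ' := by fun_prop
  have hGc : Continuous fun t : ℝ => ‖fderiv ℝ φ (x₀ + t • d)‖ :=
    ((hφ.continuous_fderiv (by simp)).comp (by fun_prop)).norm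
  have h1 : ∫ t in Icc (0 : ℝ) 1, ψ' t = φ y ^ 2 := by
    rw [integral_Icc_eq_integral_Ioc, ← intervalIntegral.integral_of_le zero_le_one,
      intervalIntegral.integral_eq_sub_of_hasDerivAt (fun t _ => hder t)
        (hc.intervalIntegrable _ _)]
    simp [hd]
  let g : ℝ → ℝ := fun t =>
    t * (3 * φ (x₀ + t • d) ^ 2 + K.diam ^ 2 * ‖fderiv ℝ φ (x₀ + t • d)‖ ^ 2)
  have hgc : Continuous g := by fun_prop
  have h2 : φ y ^ 2 ≤ ∫ t in Icc (0 : ℝ) 1, g t := by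
    rw [← h1]
    refine setIntegral_mono_on (hc.continuousOn.integrableOn_compact isCompact_Icc)
      (hgc.continuousOn.integrableOn_compact isCompact_Icc) measurableSet_Icc fun t ht => ?_
    have h3 : fderiv ℝ φ (x₀ + t • d) d ^ 2 ≤
        K.diam ^ 2 * ‖fderiv ℝ φ (x₀ + t • d)‖ ^ 2 := by
      rw [← sq_abs, ← Real.norm_eq_abs, ← mul_pow]
      refine pow_le_pow_left₀ (norm_nonneg _) ?_ 2
      refine (ContinuousLinearMap.le_opNorm _ _).trans ?_
      rw [mul_comm]
      gcongr
    simp only [hψ', g]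
    generalize φ (x₀ + t • d) = p at *
    generalize fderiv ℝ φ (x₀ + t • d) d = q at *
    have h4 : t * (2 * p * q) ≤ p ^ 2 + q ^ 2 := by
      nlinarith [sq_nonneg (p - q), sq_nonneg (p + q), ht.1, ht.2]
    nlinarith [mul_le_mul_of_nonneg_left h4 ht.1, mul_le_mul_of_nonneg_left h3 ht.1]
  calc ‖φ y‖ₑ ^ 2 = ENNReal.ofReal (φ y ^ 2) := by
        rw [← ofReal_norm, ← ENNReal.ofReal_pow (norm_nonneg _), Real.norm_eq_abs, sq_abs]
    _ ≤ ENNReal.ofReal (∫ t in Icc (0 : ℝ) 1, g t) := ENNReal.ofReal_le_ofReal h2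
    _ = ∫⁻ t in Icc (0 : ℝ) 1, ENNReal.ofReal (g t) := by
        refine ofReal_integral_eq_lintegral_ofReal
          (hgc.continuousOn.integrableOn_compact isCompact_Icc) ?_
        filter_upwards [ae_restrict_mem measurableSet_Icc] with t ht
        have := ht.1
        simp only [Pi.zero_apply, g]
        positivity
    _ = _ := by
        refine setLIntegral_congr_fun measurableSet_Icc fun t ht => ?_
        have hm : x₀ + t • d ∈ K.carrier := by
          have := hs hy (sub_nonneg.2 ht.2) ht.1 (by ring)
          convert this using 1
          rw [hd, smul_sub, sub_smul, one_smul]; abel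
        simp only [g]
        rw [indicator_of_mem hm, ENNReal.ofReal_mul ht.1, ENNReal.ofReal_add (by positivity)
          (by positivity), ENNReal.ofReal_mul (by norm_num), ENNReal.ofReal_mul (by positivity),
          ← ofReal_norm, ← ofReal_norm, norm_gradient, ← ENNReal.ofReal_pow (norm_nonneg _),
          ← ENNReal.ofReal_pow (norm_nonneg _), Real.norm_eq_abs, sq_abs]
        norm_num

/-- The trace inequality on one side `[a, b]` of `K`.  It integrates the derivative of
`t² φ(x₀ + t (y - x₀))²` along the segments from the center `x₀` to the points `y` of the side;
these segments fill the triangle with vertices `x₀, a, b`, whose height is at least `ρ`. -/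
theorem lintegral_side_le {φ : Plane → ℝ} (hφ : ContDiff ℝ ∞ φ)
    (hB : ∀ y ∈ Metric.ball x₀ ρ, StarConvex ℝ y K.carrier) (hρ : 0 < ρ) (i : Fin K.numV) :
    ∫⁻ x in K.poly.edgeSet ℝ i, ‖φ x‖ₑ ^ 2 ∂μH[1] ≤ ENNReal.ofReal ρ⁻¹ *
      (3 * (∫⁻ x in K.carrier, ‖φ x‖ₑ ^ 2) +
        ENNReal.ofReal (K.diam ^ 2) * ∫⁻ x in K.carrier, ‖gradient φ x‖ₑ ^ 2) := by
  have hx₀ : x₀ ∈ Metric.ball x₀ ρ := Metric.mem_ball_self hρ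
  have hcross := radius_mul_le_abs_cross hB i
  have hdist : 0 < dist (K.poly i) (K.poly (finRotate K.numV i)) :=
    dist_pos.2 (K.vertex_finRotate_ne i)
  have hside : ∀ s ∈ Icc (0 : ℝ) 1,
      K.poly i + s • (K.poly (finRotate K.numV i) - K.poly i) ∈ K.carrier := fun s hs =>
    K.frontier_subset (K.edgeSet_subset_frontier i
      ⟨s, hs, by rw [AffineMap.lineMap_apply_module', add_comm]⟩)
  have hm1 : Measurable fun z => ‖φ z‖ₑ ^ 2 := hφ.continuous.enorm.measurable.pow_const 2
  have hm2 : Measurable fun z => ‖gradient φ z‖ₑ ^ 2 :=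
    (continuous_gradient hφ).enorm.measurable.pow_const 2
  set F : Plane → ENNReal := K.carrier.indicator
    (fun z => 3 * ‖φ z‖ₑ ^ 2 + ENNReal.ofReal (K.diam ^ 2) * ‖gradient φ z‖ₑ ^ 2)
  have hFm : Measurable F :=
    ((hm1.const_mul _).add (hm2.const_mul _)).indicator K.measurableSet_carrier
  have hFI : ∫⁻ x, F x = 3 * (∫⁻ x in K.carrier, ‖φ x‖ₑ ^ 2) +
        ENNReal.ofReal (K.diam ^ 2) * ∫⁻ x in K.carrier, ‖gradient φ x‖ₑ ^ 2 := by
    rw [lintegral_indicator K.measurableSet_carrier, lintegral_add_left (hm1.const_mul _),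
      lintegral_const_mul _ hm1, lintegral_const_mul _ hm2]
  rw [Polygon.edgeSet, lintegral_affineSegment hm1]
  set a := K.poly i
  set b := K.poly (finRotate K.numV i)
  have hcp : 0 < |cross (a - x₀) (b - a)| := lt_of_lt_of_le (by positivity) hcross
  rw [← hFI]
  calc ENNReal.ofReal (dist a b) * ∫⁻ s in Icc (0 : ℝ) 1, ‖φ (a + s • (b - a))‖ₑ ^ 2
      ≤ ENNReal.ofReal (dist a b) * ∫⁻ s in Icc (0 : ℝ) 1, ∫⁻ t in Icc (0 : ℝ) 1,
          ENNReal.ofReal t * F (x₀ + t • (a + s • (b - a) - x₀)) := by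
        gcongr 1
        refine setLIntegral_mono' measurableSet_Icc fun s hs => ?_
        exact enorm_sq_le_lintegral hφ (hside s hs) (ball_subset_of_starConvex hB hx₀) (hB _ hx₀)
    _ ≤ ENNReal.ofReal (ρ⁻¹ * |cross (a - x₀) (b - a)|) *
          ∫⁻ s in Icc (0 : ℝ) 1, ∫⁻ t in Icc (0 : ℝ) 1,
          ENNReal.ofReal t * F (x₀ + t • (a + s • (b - a) - x₀)) := by
        gcongr
        rw [← div_eq_inv_mul, le_div_iff₀ hρ, mul_comm]
        exact hcross
    _ ≤ _ := by
        rw [ENNReal.ofReal_mul (by positivity), mul_assoc]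
        gcongr
        exact lintegral_triangle_le hFm x₀ a b (abs_pos.1 hcp)

end SimplePolygon

/-! ### Square-integrable functions -/

theorem ennreal_add_sq_le (a b : ENNReal) : (a + b) ^ 2 ≤ 2 * (a ^ 2 + b ^ 2) := by
  have h := ENNReal.rpow_add_le_mul_rpow_add_rpow a b one_le_two
  norm_num at h
  exact h

theorem eLpNorm_two_sq {α E : Type*} [MeasurableSpace α] [NormedAddCommGroup E] (f : α → E)
    (μ : Measure α) : eLpNorm f 2 μ ^ 2 = ∫⁻ x, ‖f x‖ₑ ^ 2 ∂μ := by
  simpa using eLpNorm_nnreal_pow_eq_lintegral (p := 2) (f := f) (μ := μ) two_ne_zero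

/-- If `f - g` is orthogonal to `g` in `L²`, then `g` is no longer than `f`. -/
theorem eLpNorm_le_of_integral_inner_eq {α E : Type*} [MeasurableSpace α] {μ : Measure α}
    [NormedAddCommGroup E] [InnerProductSpace ℝ E] {f g : α → E} (hf : MemLp f 2 μ)
    (hg : MemLp g 2 μ) (h : ∫ x, inner ℝ (g x) (g x) ∂μ = ∫ x, inner ℝ (f x) (g x) ∂μ) :
    eLpNorm g 2 μ ≤ eLpNorm f 2 μ := by
  have hi : ∀ (u v : α → E) (hu : MemLp u 2 μ) (hv : MemLp v 2 μ),
      inner ℝ (hu.toLp u) (hv.toLp v) = ∫ x, inner ℝ (u x) (v x) ∂μ := by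
    intro u v hu hv
    rw [L2.inner_def]
    refine integral_congr_ae ?_
    filter_upwards [hu.coeFn_toLp, hv.coeFn_toLp] with x h1 h2
    rw [h1, h2]
  rw [← hi g g hg hg, ← hi f g hf hg] at h
  have h1 : ‖hg.toLp g‖ * ‖hg.toLp g‖ ≤ ‖hf.toLp f‖ * ‖hg.toLp g‖ := by
    rw [← real_inner_self_eq_norm_mul_norm, h]
    exact real_inner_le_norm _ _
  have h2 : ‖hg.toLp g‖ ≤ ‖hf.toLp f‖ := by
    rcases (norm_nonneg (hg.toLp g)).eq_or_lt with h0 | h0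
    · rw [← h0]; exact norm_nonneg _
    · exact le_of_mul_le_mul_right h1 h0
  rw [← Lp.enorm_toLp hf, ← Lp.enorm_toLp hg]
  exact enorm_le_iff_norm_le.2 h2

/-! ### Affine functions and weak gradients -/

theorem P1.contDiff {q : Plane → ℝ} (hq : q ∈ P1) : ContDiff ℝ ∞ q := by
  obtain ⟨a, b, h⟩ := hq
  rw [funext h]
  exact contDiff_const.add (contDiff_const.inner ℝ contDiff_id)

theorem gradient_affine {q : Plane → ℝ} {a : ℝ} {b : Plane} (h : ∀ x, q x = a + inner ℝ b x) :
    gradient q = fun _ => b := by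
  rw [funext h]
  refine gradient_eq fun x => ?_
  rw [hasGradientAt_iff_hasFDerivAt]
  exact (((InnerProductSpace.toDual ℝ Plane) b).hasFDerivAt (x := x)).const_add a

namespace SimplePolygon

variable {K : SimplePolygon} {v v' : Plane → ℝ} {G G' : Plane → Plane}

theorem HasWeakGrad.congr (h : K.HasWeakGrad v G) (hv : v =ᵐ[K.area] v') : K.HasWeakGrad v' G := by
  refine ⟨h.1, fun φ h1 h2 h3 => ?_⟩
  rw [← h.2 φ h1 h2 h3]
  exact integral_congr_ae (hv.mono fun x hx => by simp only [hx])

/-- Weak gradients are unique, by the fundamental lemma of the calculus of variations. -/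
theorem HasWeakGrad.ae_eq (h : K.HasWeakGrad v G) (h' : K.HasWeakGrad v G') :
    G =ᵐ[K.area] G' := by
  have hd : MemLp (fun x => G x - G' x) 2 K.area := h.1.sub h'.1
  have key := isOpen_interior.ae_eq_zero_of_integral_contDiff_smul_eq_zero (μ := K.area)
    (U := interior K.carrier) (f := fun x => G x - G' x)
    ((hd.integrable one_le_two).locallyIntegrable.locallyIntegrableOn _)
    (fun φ h1 h2 h3 => by
      have hφ : ∀ {F : Plane → Plane}, MemLp F 2 K.area →
          Integrable (fun x => φ x • F x) K.area := fun hF =>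
        (hF.integrable one_le_two).locallyIntegrable.integrable_smul_left_of_hasCompactSupport
          h1.continuous h2
      simp only [smul_sub]
      rw [integral_sub (hφ h.1) (hφ h'.1), sub_eq_zero, ← neg_inj, ← h.2 φ h1 h2 h3,
        ← h'.2 φ h1 h2 h3])
  filter_upwards [key, K.ae_mem_interior] with x hx hxi
  exact sub_eq_zero.1 (hx hxi)

theorem MemH1.hasWeakGrad (h : K.MemH1 v) : K.HasWeakGrad v (K.weakGrad v) :=
  Classical.epsilon_spec h.2

theorem memLp_of_continuous {E : Type*} [NormedAddCommGroup E] [SecondCountableTopology E]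
    [MeasurableSpace E] [BorelSpace E] {f : Plane → E} (hf : Continuous f) {μ : Measure Plane}
    [IsFiniteMeasure μ] (hμ : ∀ᵐ x ∂μ, x ∈ K.carrier) : MemLp f 2 μ := by
  obtain ⟨C, hC⟩ := K.isCompact_carrier.exists_bound_of_continuousOn hf.continuousOn
  exact MemLp.of_bound hf.aestronglyMeasurable C (hμ.mono hC)

theorem ae_mem_carrier_area : ∀ᵐ x ∂K.area, x ∈ K.carrier :=
  ae_restrict_mem K.measurableSet_carrier

theorem ae_mem_carrier_arc : ∀ᵐ x ∂K.arc, x ∈ K.carrier :=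
  (ae_restrict_mem isClosed_frontier.measurableSet).mono fun _ hx => K.frontier_subset hx

/-- Integration by parts, tested with an arbitrary vector `c`. -/
theorem hasWeakGrad_affine {q : Plane → ℝ} (hq : q ∈ P1) : K.HasWeakGrad q (gradient q) := by
  have hqs := P1.contDiff hq
  refine ⟨K.memLp_of_continuous (continuous_gradient hqs) K.ae_mem_carrier_area,
    fun φ h1 h2 h3 => ?_⟩
  have hz : ∀ x ∉ K.carrier, φ x = 0 := fun x hx => by
    by_contra hne
    exact hx (interior_subset (h3 (subset_tsupport _ hne)))
  have hz' : ∀ x ∉ K.carrier, gradient φ x = 0 := fun x hx => by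
    have : fderiv ℝ φ x = 0 := by
      by_contra hne
      exact hx (interior_subset (h3 (support_fderiv_subset ℝ hne)))
    rw [gradient, this, map_zero]
  rw [area, setIntegral_eq_integral_of_forall_compl_eq_zero fun x hx => by rw [hz' x hx, smul_zero],
    setIntegral_eq_integral_of_forall_compl_eq_zero fun x hx => by rw [hz x hx, zero_smul]]
  have hgs : HasCompactSupport (gradient φ) := (h2.fderiv ℝ).comp_left (map_zero _)
  have hqc := hqs.continuous
  have hφc := h1.continuous
  have hdφ : ∀ c, Continuous fun x => fderiv ℝ φ x c := fun c =>
    (h1.continuous_fderiv (by simp)).clm_apply continuous_const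
  have hdq : ∀ c, Continuous fun x => fderiv ℝ q x c := fun c =>
    (hqs.continuous_fderiv (by simp)).clm_apply continuous_const
  have hgq : Continuous (gradient q) := continuous_gradient hqs
  have hgφ : Continuous (gradient φ) := continuous_gradient h1
  refine ext_inner_left ℝ fun c => ?_
  have hinner : ∀ (f : Plane → ℝ) x, inner ℝ c (gradient f x) = fderiv ℝ f x c := fun f x => by
    rw [real_inner_comm, inner_gradient_left]
  rw [inner_neg_right, ← integral_inner, ← integral_inner]
  · simp only [inner_smul_right, hinner]
    rw [integral_mul_fderiv_eq_neg_fderiv_mul_of_integrable]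
    · simp only [mul_comm]
    · exact ((hdq c).mul hφc).integrable_of_hasCompactSupport h2.mul_left
    · refine (hqc.mul (hdφ c)).integrable_of_hasCompactSupport
        (HasCompactSupport.mul_left ?_)
      exact (h2.fderiv ℝ).comp_left (g := fun L : Plane →L[ℝ] ℝ => L c) rfl
    · exact (hqc.mul hφc).integrable_of_hasCompactSupport h2.mul_left
    · exact fun x _ => hqs.differentiable (by simp) x
    · exact fun x _ => h1.differentiable (by simp) x
  · exact (hφc.smul hgq).integrable_of_hasCompactSupport h2.smul_right
  · exact (hqc.smul hgφ).integrable_of_hasCompactSupport hgs.smul_left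

theorem memH1_of_ae_eq_affine {q : Plane → ℝ} (hq : q ∈ P1) (hv : v =ᵐ[K.area] q) :
    K.MemH1 v :=
  ⟨(memLp_congr_ae hv).2 (K.memLp_of_continuous (P1.contDiff hq).continuous K.ae_mem_carrier_area),
    _, (K.hasWeakGrad_affine hq).congr hv.symm⟩

theorem weakGrad_ae_eq_of_ae_eq_affine {q : Plane → ℝ} (hq : q ∈ P1) (hv : v =ᵐ[K.area] q) :
    K.weakGrad v =ᵐ[K.area] gradient q :=
  (memH1_of_ae_eq_affine hq hv).hasWeakGrad.ae_eq ((K.hasWeakGrad_affine hq).congr hv.symm)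

theorem isTrace_of_ae_eq_affine {q : Plane → ℝ} (hq : q ∈ P1) (hv : v =ᵐ[K.area] q) :
    K.IsTrace v q := by
  have hqs := P1.contDiff hq
  refine ⟨memH1_of_ae_eq_affine hq hv, K.memLp_of_continuous hqs.continuous K.ae_mem_carrier_arc,
    fun _ => q, fun _ => hqs, ?_, ?_, by simp⟩
  · have h : (fun x => q x - v x) =ᵐ[K.area] 0 := hv.mono fun x hx => by simp [hx]
    simp [eLpNorm_congr_ae h]
  · have h : (fun x => gradient q x - K.weakGrad v x) =ᵐ[K.area] 0 :=
      (weakGrad_ae_eq_of_ae_eq_affine hq hv).mono fun x hx => by simp [hx]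
    simp [eLpNorm_congr_ae h]

theorem IsTrace.trace {g : Plane → ℝ} (h : K.IsTrace v g) : K.IsTrace v (K.trace v) :=
  Classical.epsilon_spec ⟨g, h⟩

/-! ### The local projection -/

/-- The gradient of the projection is the mean value of `∇v` on `K`; the constant term is then
fixed by the mean value on `∂K`. -/
theorem exists_isProj (hv : K.MemH1 v) (ht : MemLp (K.trace v) 2 K.arc) :
    ∃ q, K.IsProj v q := by
  have hG := hv.hasWeakGrad.1.integrable one_le_two
  have hT := ht.integrable one_le_two
  set V := K.area.real univ with hV
  have hV0 : V ≠ 0 := by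
    rw [hV, measureReal_def, area, Measure.restrict_apply_univ]
    exact (ENNReal.toReal_pos K.volume_carrier_pos.ne' K.volume_carrier_ne_top).ne'
  set A := K.arc.real univ with hA
  have hA0 : A ≠ 0 := by
    rw [hA, measureReal_def]
    exact (ENNReal.toReal_pos (by simpa using K.arc_ne_zero) (measure_ne_top _ _)).ne'
  set b : Plane := V⁻¹ • ∫ x, K.weakGrad v x ∂K.area with hb
  set a : ℝ := A⁻¹ * ∫ x, (K.trace v x - inner ℝ b x) ∂K.arc with ha
  have hbi : Integrable (fun x => inner ℝ b x) K.arc :=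
    (K.memLp_of_continuous (by fun_prop) K.ae_mem_carrier_arc).integrable one_le_two
  refine ⟨fun x => a + inner ℝ b x, ⟨a, b, fun _ => rfl⟩, ?_, ?_⟩
  · rintro p ⟨a', c, hp⟩
    rw [gradient_affine (fun _ => rfl), gradient_affine hp]
    simp only [real_inner_comm c]
    rw [integral_inner hG, integral_const, ← hV, hb, inner_smul_right, smul_eq_mul,
      mul_inv_cancel_left₀ hV0]
  · have h1 : ∀ x, K.trace v x - (a + inner ℝ b x) = (K.trace v x - inner ℝ b x) - a :=
      fun x => by ring
    simp only [h1]
    have h2 : Integrable (fun x => K.trace v x - inner ℝ b x) K.arc := hT.sub hbi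
    rw [integral_sub h2 (integrable_const _), integral_const, ← hA, ha, smul_eq_mul,
      mul_inv_cancel_left₀ hA0, sub_self]

theorem isProj_proj (hv : K.MemH1 v) (ht : MemLp (K.trace v) 2 K.arc) :
    K.IsProj v (K.proj v) := Classical.epsilon_spec (exists_isProj hv ht)

theorem IsProj.eLpNorm_gradient_le {q : Plane → ℝ} (h : K.IsProj v q) (hv : K.MemH1 v) :
    eLpNorm (gradient q) 2 K.area ≤ eLpNorm (K.weakGrad v) 2 K.area :=
  eLpNorm_le_of_integral_inner_eq hv.hasWeakGrad.1 (K.hasWeakGrad_affine h.1).1 (h.2.1 q h.1)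

/-- For `w ∈ W(K)`, the projection is the `L²`-projection onto the affine functions. -/
theorem eLpNorm_proj_le {w : Plane → ℝ} (hw : w ∈ K.W) (hq : K.proj w ∈ P1) :
    eLpNorm (K.proj w) 2 K.area ≤ eLpNorm w 2 K.area := by
  have hwL : MemLp w 2 K.area := hw.1.1.1
  have hqL : MemLp (K.proj w) 2 K.area :=
    K.memLp_of_continuous (P1.contDiff hq).continuous K.ae_mem_carrier_area
  refine eLpNorm_le_of_integral_inner_eq hwL hqL ?_
  have h := hw.2 _ hq
  simp only [sub_mul] at h
  have i1 : Integrable (fun x => w x * K.proj w x) K.area := hwL.integrable_mul hqL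
  have i2 : Integrable (fun x => K.proj w x * K.proj w x) K.area := hqL.integrable_mul hqL
  rw [integral_sub i1 i2, sub_eq_zero] at h
  simp only [RCLike.inner_apply, conj_trivial]
  rw [← h]
  simp only [mul_comm]

/-! ### The trace inequality for functions with mean value zero -/

variable {x₀ : Plane}

/-- The trace inequality followed by the Poincaré inequality, with all powers of the diameter made
explicit. -/
theorem lintegral_side_le_of_diam {γ : ℝ} (hγ : 0 < γ) {φ : Plane → ℝ} (hφ : ContDiff ℝ ∞ φ)
    (hB : ∀ y ∈ Metric.ball x₀ (γ * K.diam), StarConvex ℝ y K.carrier) (i : Fin K.numV) :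
    ∫⁻ x in K.poly.edgeSet ℝ i, ‖φ x‖ₑ ^ 2 ∂μH[1] ≤
      ENNReal.ofReal (γ * K.diam)⁻¹ * (3 * (volume K.carrier)⁻¹) *
          ‖∫ x in K.carrier, φ x‖ₑ ^ 2 +
        ENNReal.ofReal ((12 / γ ^ 2 + 1) / γ * K.diam) *
          ∫⁻ x in K.carrier, ‖gradient φ x‖ₑ ^ 2 := by
  have hD := K.diam_pos
  have hρ : 0 < γ * K.diam := mul_pos hγ hD
  refine (lintegral_side_le hφ hB hρ i).trans ?_
  have h1 := poincare hφ hB hρ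
  set c := ENNReal.ofReal (4 * K.diam ^ 2 * (K.diam / (γ * K.diam)) ^ 2) with hc
  have hconst : ENNReal.ofReal ((12 / γ ^ 2 + 1) / γ * K.diam) =
      ENNReal.ofReal (γ * K.diam)⁻¹ * (3 * c + ENNReal.ofReal (K.diam ^ 2)) := by
    rw [hc, show (3 : ENNReal) = ENNReal.ofReal 3 by norm_num, ← ENNReal.ofReal_mul (by norm_num),
      ← ENNReal.ofReal_add (by positivity) (by positivity), ← ENNReal.ofReal_mul (by positivity)]
    congr 1
    field_simp
    ring
  rw [hconst]
  set D := ∫⁻ x in K.carrier, ‖gradient φ x‖ₑ ^ 2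
  set m := ‖∫ x in K.carrier, φ x‖ₑ ^ 2
  calc _ ≤ ENNReal.ofReal (γ * K.diam)⁻¹ *
        (3 * ((volume K.carrier)⁻¹ * m + c * D) + ENNReal.ofReal (K.diam ^ 2) * D) := by gcongr
    _ = _ := by ring

/-- The trace inequality passes to limits of smooth functions. -/
theorem lintegral_side_le_of_tendsto {γ : ℝ} (hγ : 0 < γ)
    (hB : ∀ y ∈ Metric.ball x₀ (γ * K.diam), StarConvex ℝ y K.carrier) (i : Fin K.numV)
    {φ : ℕ → Plane → ℝ} (hφ : ∀ n, ContDiff ℝ ∞ (φ n)) {u g : Plane → ℝ} {G : Plane → Plane}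
    (hu : MemLp u 2 K.area) (hg : MemLp g 2 K.arc) (hG : MemLp G 2 K.area)
    (hmean : ∫ x, u x ∂K.area = 0)
    (h1 : Tendsto (fun n => eLpNorm (fun x => φ n x - u x) 2 K.area) atTop (𝓝 0))
    (h2 : Tendsto (fun n => eLpNorm (fun x => gradient (φ n) x - G x) 2 K.area) atTop (𝓝 0))
    (h3 : Tendsto (fun n => eLpNorm (fun x => φ n x - g x) 2 K.arc) atTop (𝓝 0)) :
    ∫⁻ x in K.poly.edgeSet ℝ i, ‖g x‖ₑ ^ 2 ∂μH[1] ≤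
      ENNReal.ofReal (4 * ((12 / γ ^ 2 + 1) / γ) * K.diam) * eLpNorm G 2 K.area ^ 2 := by
  set A : ENNReal := ENNReal.ofReal (γ * K.diam)⁻¹ * (3 * (volume K.carrier)⁻¹) with hA
  set c : ENNReal := ENNReal.ofReal ((12 / γ ^ 2 + 1) / γ * K.diam) with hc
  set S : Measure Plane := (μH[1] : Measure Plane).restrict (K.poly.edgeSet ℝ i) with hS
  have hSle : S ≤ K.arc := Measure.restrict_mono (K.edgeSet_subset_frontier i) le_rfl
  have hA_top : A ≠ ⊤ := ENNReal.mul_ne_top ENNReal.ofReal_ne_top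
    (ENNReal.mul_ne_top (by norm_num) (ENNReal.inv_ne_top.2 K.volume_carrier_pos.ne'))
  have hφL : ∀ n, MemLp (φ n) 2 K.area := fun n =>
    K.memLp_of_continuous (hφ n).continuous K.ae_mem_carrier_area
  have hgφL : ∀ n, MemLp (gradient (φ n)) 2 K.area := fun n =>
    K.memLp_of_continuous (continuous_gradient (hφ n)) K.ae_mem_carrier_area
  have hbound : ∀ n, eLpNorm g 2 S ^ 2 ≤ 4 * c * eLpNorm G 2 K.area ^ 2 +
      (2 * eLpNorm (fun x => φ n x - g x) 2 K.arc ^ 2 +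
        2 * A * volume K.carrier * eLpNorm (fun x => φ n x - u x) 2 K.area ^ 2 +
        4 * c * eLpNorm (fun x => gradient (φ n) x - G x) 2 K.area ^ 2) := by
    intro n
    have e1 : eLpNorm g 2 S ≤ eLpNorm (fun x => φ n x - g x) 2 K.arc + eLpNorm (φ n) 2 S := by
      calc eLpNorm g 2 S = eLpNorm (fun x => φ n x - (φ n x - g x)) 2 S := by simp
        _ ≤ eLpNorm (φ n) 2 S + eLpNorm (fun x => φ n x - g x) 2 S :=
          eLpNorm_sub_le (hφ n).continuous.aestronglyMeasurable
            ((hφ n).continuous.aestronglyMeasurable.sub (hg.1.mono_measure hSle)) one_le_two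
        _ ≤ _ := by
          rw [add_comm]
          gcongr
    have e2 : eLpNorm (gradient (φ n)) 2 K.area ≤ eLpNorm G 2 K.area +
        eLpNorm (fun x => gradient (φ n) x - G x) 2 K.area := by
      calc _ = eLpNorm (fun x => G x + (gradient (φ n) x - G x)) 2 K.area := by simp
        _ ≤ _ := eLpNorm_add_le hG.1 ((hgφL n).1.sub hG.1) one_le_two
    have e3 : ‖∫ x, φ n x ∂K.area‖ₑ ^ 2 ≤
        volume K.carrier * eLpNorm (fun x => φ n x - u x) 2 K.area ^ 2 := by
      have : ∫ x, φ n x ∂K.area = ∫ x, (φ n x - u x) ∂K.area := by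
        rw [integral_sub ((hφL n).integrable one_le_two) (hu.integrable one_le_two), hmean,
          sub_zero]
      rw [this, eLpNorm_two_sq]
      refine (enorm_integral_sq_le ((hφL n).1.sub hu.1)).trans_eq ?_
      rw [area, Measure.restrict_apply_univ]
      rfl
    have e4 : eLpNorm (φ n) 2 S ^ 2 ≤ A * ‖∫ x, φ n x ∂K.area‖ₑ ^ 2 +
        c * eLpNorm (gradient (φ n)) 2 K.area ^ 2 := by
      rw [eLpNorm_two_sq, eLpNorm_two_sq]
      exact lintegral_side_le_of_diam hγ (hφ n) hB i
    calc eLpNorm g 2 S ^ 2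
        ≤ (eLpNorm (fun x => φ n x - g x) 2 K.arc + eLpNorm (φ n) 2 S) ^ 2 := by gcongr
      _ ≤ 2 * (eLpNorm (fun x => φ n x - g x) 2 K.arc ^ 2 + eLpNorm (φ n) 2 S ^ 2) :=
        ennreal_add_sq_le _ _
      _ ≤ 2 * (eLpNorm (fun x => φ n x - g x) 2 K.arc ^ 2 +
            (A * (volume K.carrier * eLpNorm (fun x => φ n x - u x) 2 K.area ^ 2) +
              c * (2 * (eLpNorm G 2 K.area ^ 2 +
                eLpNorm (fun x => gradient (φ n) x - G x) 2 K.area ^ 2)))) := by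
        gcongr
        refine e4.trans ?_
        gcongr
        exact (pow_le_pow_left' e2 2).trans (ennreal_add_sq_le _ _)
      _ = _ := by ring
  have hlim : Tendsto (fun n => 4 * c * eLpNorm G 2 K.area ^ 2 +
      (2 * eLpNorm (fun x => φ n x - g x) 2 K.arc ^ 2 +
        2 * A * volume K.carrier * eLpNorm (fun x => φ n x - u x) 2 K.area ^ 2 +
        4 * c * eLpNorm (fun x => gradient (φ n) x - G x) 2 K.area ^ 2)) atTop
      (𝓝 (4 * c * eLpNorm G 2 K.area ^ 2)) := by
    have hz : ∀ {f : ℕ → ENNReal} {k : ENNReal}, k ≠ ⊤ → Tendsto f atTop (𝓝 0) →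
        Tendsto (fun n => k * f n ^ 2) atTop (𝓝 0) := by
      intro f k hk hf
      have h : Tendsto (fun n => f n ^ 2) atTop (𝓝 0) := by
        simpa using ENNReal.Tendsto.pow (n := 2) hf
      simpa using ENNReal.Tendsto.const_mul h (Or.inr hk)
    have k1 : (2 : ENNReal) ≠ ⊤ := by norm_num
    have k2 : 2 * A * volume K.carrier ≠ ⊤ :=
      ENNReal.mul_ne_top (ENNReal.mul_ne_top k1 hA_top) K.volume_carrier_ne_top
    have k3 : 4 * c ≠ ⊤ := ENNReal.mul_ne_top (by norm_num) ENNReal.ofReal_ne_top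
    simpa using ((hz k1 h3).add (hz k2 h1)).add (hz k3 h2) |>.const_add
      (4 * c * eLpNorm G 2 K.area ^ 2)
  have hfin := ge_of_tendsto' hlim hbound
  rw [eLpNorm_two_sq] at hfin
  refine hfin.trans_eq ?_
  rw [hc, mul_assoc (4 : ℝ), ENNReal.ofReal_mul (by norm_num : (0 : ℝ) ≤ 4)]
  norm_num

/-! ### Estimates on one element -/

variable {w : Plane → ℝ}

theorem gradient_sub {φ ψ : Plane → ℝ} (hφ : ContDiff ℝ ∞ φ) (hψ : ContDiff ℝ ∞ ψ) (x : Plane) :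
    gradient (fun x => φ x - ψ x) x = gradient φ x - gradient ψ x := by
  simp only [gradient]
  rw [← map_sub, fderiv_fun_sub (hφ.differentiable (by simp) x) (hψ.differentiable (by simp) x)]

theorem isTrace_trace_of_mem_W (hw : w ∈ K.W) : K.IsTrace w (K.trace w) := by
  obtain ⟨⟨-, ⟨g, -, hg⟩, -⟩, -⟩ := hw
  exact hg.trace

theorem isProj_of_mem_W (hw : w ∈ K.W) : K.IsProj w (K.proj w) :=
  isProj_proj hw.1.1 (isTrace_trace_of_mem_W hw).2.1

theorem eLpNorm_weakGrad_le (hw : w ∈ K.W) (hv : v =ᵐ[K.area] K.proj w) :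
    eLpNorm (K.weakGrad v) 2 K.area ≤ eLpNorm (K.weakGrad w) 2 K.area := by
  have hp := isProj_of_mem_W hw
  rw [eLpNorm_congr_ae (weakGrad_ae_eq_of_ae_eq_affine hp.1 hv)]
  exact hp.eLpNorm_gradient_le hw.1.1

theorem StarShapedWrtDisk.exists_center {γ : ℝ} (h : K.StarShapedWrtDisk γ) :
    ∃ x₀, ∀ y ∈ Metric.ball x₀ (γ * K.diam), StarConvex ℝ y K.carrier := by
  obtain ⟨x₀, ρ, hρ, h⟩ := h
  exact ⟨x₀, fun y hy => h y (Metric.ball_subset_ball hρ hy)⟩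

/-- The trace of the projection error on a side, bounded by the energy: the error has mean value
zero on `K`, by the definition of `W(K)`. -/
theorem lintegral_side_trace_sub_le {γ : ℝ} (hγ : 0 < γ) (hs : K.StarShapedWrtDisk γ)
    (hw : w ∈ K.W) (hv : v =ᵐ[K.area] K.proj w) (i : Fin K.numV) :
    ∫⁻ x in K.poly.edgeSet ℝ i, ‖K.trace v x - K.trace w x‖ₑ ^ 2 ∂μH[1] ≤
      ENNReal.ofReal (16 * ((12 / γ ^ 2 + 1) / γ) * K.diam) *
        eLpNorm (K.weakGrad w) 2 K.area ^ 2 := by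
  obtain ⟨x₀, hB⟩ := hs.exists_center
  have hp := isProj_of_mem_W hw
  obtain ⟨hwH, hwT, χ, hχ, hχ1, hχ2, hχ3⟩ := isTrace_trace_of_mem_W hw
  obtain ⟨hvH, hvT, ψ, hψ, hψ1, hψ2, hψ3⟩ := (isTrace_of_ae_eq_affine hp.1 hv).trace
  have hGw := hwH.hasWeakGrad.1
  have hGv := hvH.hasWeakGrad.1
  have hlim : ∀ {E : Type} [NormedAddCommGroup E] {μ : Measure Plane} {f g : ℕ → Plane → E}
      {f₀ g₀ : Plane → E}, (∀ n, AEStronglyMeasurable (f n) μ) →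
      (∀ n, AEStronglyMeasurable (g n) μ) → AEStronglyMeasurable f₀ μ →
      AEStronglyMeasurable g₀ μ →
      Tendsto (fun n => eLpNorm (fun x => f n x - f₀ x) 2 μ) atTop (𝓝 0) →
      Tendsto (fun n => eLpNorm (fun x => g n x - g₀ x) 2 μ) atTop (𝓝 0) →
      Tendsto (fun n => eLpNorm (fun x => (f n x - g n x) - (f₀ x - g₀ x)) 2 μ) atTop (𝓝 0) := by
    intro E _ μ f g f₀ g₀ hf hg hf₀ hg₀ h1 h2
    refine tendsto_of_tendsto_of_tendsto_of_le_of_le tendsto_const_nhds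
      (by simpa using h1.add h2) (fun _ => zero_le) fun n => ?_
    have h3 : (fun x => (f n x - g n x) - (f₀ x - g₀ x)) =
        fun x => (f n x - f₀ x) - (g n x - g₀ x) := by
      funext x; abel
    simp only [h3]
    exact eLpNorm_sub_le ((hf n).sub hf₀) ((hg n).sub hg₀) one_le_two
  have hmean : ∫ x, (v x - w x) ∂K.area = 0 := by
    have h1 := hw.2 (fun _ => 1) ⟨1, 0, fun x => by simp⟩
    -- the test function `1` in the definition of `W(K)`
    rw [← neg_eq_zero, ← integral_neg, ← h1]
    refine integral_congr_ae (hv.mono fun x hx => ?_)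
    simp [hx]
  have key := lintegral_side_le_of_tendsto hγ hB i (φ := fun n x => ψ n x - χ n x)
    (u := fun x => v x - w x) (g := fun x => K.trace v x - K.trace w x)
    (G := fun x => K.weakGrad v x - K.weakGrad w x) (fun n => (hψ n).sub (hχ n))
    (hvH.1.sub hwH.1) (hvT.sub hwT) (hGv.sub hGw) hmean
    (hlim (fun n => (hψ n).continuous.aestronglyMeasurable)
      (fun n => (hχ n).continuous.aestronglyMeasurable) hvH.1.1 hwH.1.1 hψ1 hχ1)
    (by
      simp only [gradient_sub (hψ _) (hχ _)]
      exact hlim (fun n => (continuous_gradient (hψ n)).aestronglyMeasurable)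
        (fun n => (continuous_gradient (hχ n)).aestronglyMeasurable) hGv.1 hGw.1 hψ2 hχ2)
    (hlim (fun n => (hψ n).continuous.aestronglyMeasurable)
      (fun n => (hχ n).continuous.aestronglyMeasurable) hvT.1 hwT.1 hψ3 hχ3)
  refine key.trans ?_
  have h4 : eLpNorm (fun x => K.weakGrad v x - K.weakGrad w x) 2 K.area ≤
      2 * eLpNorm (K.weakGrad w) 2 K.area := by
    refine (eLpNorm_sub_le hGv.1 hGw.1 one_le_two).trans ?_
    rw [two_mul]
    gcongr
    exact eLpNorm_weakGrad_le hw hv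
  calc _ ≤ ENNReal.ofReal (4 * ((12 / γ ^ 2 + 1) / γ) * K.diam) *
        (2 * eLpNorm (K.weakGrad w) 2 K.area) ^ 2 := by gcongr
    _ = _ := by
      rw [show 16 * ((12 / γ ^ 2 + 1) / γ) * K.diam =
        4 * (4 * ((12 / γ ^ 2 + 1) / γ) * K.diam) by ring,
        ENNReal.ofReal_mul (by norm_num : (0 : ℝ) ≤ 4)]
      norm_num
      ring

theorem norm_outwardNormal_le (i : Fin K.numV) : ‖K.outwardNormal i‖ ≤ 1 := by
  have h : ‖K.unitNormal i‖ ≤ 1 := by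
    rw [unitNormal]
    generalize K.poly (finRotate K.numV i) - K.poly i = d
    have h1 : ‖(!₂[-d 1, d 0] : Plane)‖ = ‖d‖ := by
      rw [← sq_eq_sq₀ (norm_nonneg _) (norm_nonneg _), EuclideanSpace.norm_sq_eq,
        EuclideanSpace.norm_sq_eq, Fin.sum_univ_two, Fin.sum_univ_two]
      simp [add_comm]
    rw [norm_smul, h1, norm_inv, norm_norm]
    exact inv_mul_le_one
  rw [outwardNormal]
  split_ifs
  · exact h
  · rwa [norm_neg]

end SimplePolygon

/-! ### Counting elements, sides and edges through a point -/

/-- Two maximal segments in a subset of a given segment coincide if they meet, as their union is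
again a segment. -/
theorem eq_of_maximal_segment {a b : Plane} (hab : a ≠ b) {Z e e' : Set Plane}
    (he : Maximal (fun f : Set Plane => (∃ x y, x ≠ y ∧ f = segment ℝ x y) ∧
      f ⊆ affineSegment ℝ a b ∩ Z) e)
    (he' : Maximal (fun f : Set Plane => (∃ x y, x ≠ y ∧ f = segment ℝ x y) ∧
      f ⊆ affineSegment ℝ a b ∩ Z) e')
    {z : Plane} (hz : z ∈ e) (hz' : z ∈ e') : e = e' := by
  have hinj : Function.Injective (AffineMap.lineMap a b : ℝ → Plane) :=
    AffineMap.lineMap_injective ℝ hab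
  have hparam : ∀ f : Set Plane, (∃ x y, x ≠ y ∧ f = segment ℝ x y) ∧
      f ⊆ affineSegment ℝ a b ∩ Z →
      ∃ α β : ℝ, α < β ∧ f = AffineMap.lineMap a b '' Icc α β := by
    rintro _ ⟨⟨x, y, hxy, rfl⟩, hsub⟩
    obtain ⟨α, -, rfl⟩ := (hsub (left_mem_segment ℝ x y)).1
    obtain ⟨β, -, rfl⟩ := (hsub (right_mem_segment ℝ _ y)).1
    have hne : α ≠ β := fun h => hxy (by rw [h])
    refine ⟨min α β, max α β, min_lt_max.2 hne, ?_⟩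
    rw [← image_segment, segment_eq_uIcc]
    rfl
  have hseg : ∀ α β : ℝ, α < β → ∃ x y : Plane, x ≠ y ∧
      AffineMap.lineMap a b '' Icc α β = segment ℝ x y := fun α β h =>
    ⟨AffineMap.lineMap a b α, AffineMap.lineMap a b β, fun h' => h.ne (hinj h'), by
      rw [← image_segment, segment_eq_Icc h.le]⟩
  obtain ⟨α, β, h1, rfl⟩ := hparam e he.prop
  obtain ⟨α', β', h2, rfl⟩ := hparam e' he'.prop
  obtain ⟨t, ht, rfl⟩ := hz
  obtain ⟨t', ht', htt⟩ := hz'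
  obtain rfl := hinj htt
  have hU : AffineMap.lineMap a b '' Icc α β ∪ AffineMap.lineMap a b '' Icc α' β' =
      AffineMap.lineMap a b '' Icc (min α α') (max β β') := by
    rw [← image_union, Icc_union_Icc' (ht'.1.trans ht.2) (ht.1.trans ht'.2)]
  have hP : (∃ x y, x ≠ y ∧ AffineMap.lineMap a b '' Icc α β ∪
      AffineMap.lineMap a b '' Icc α' β' = segment ℝ x y) ∧
      AffineMap.lineMap a b '' Icc α β ∪ AffineMap.lineMap a b '' Icc α' β' ⊆
        affineSegment ℝ a b ∩ Z := by
    refine ⟨?_, union_subset he.prop.2 he'.prop.2⟩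
    rw [hU]
    exact hseg _ _ ((min_le_left _ _).trans_lt (h1.trans_le (le_max_left _ _)))
  exact Subset.antisymm (subset_union_left.trans (he'.le_of_ge hP subset_union_right))
    (subset_union_right.trans (he.le_of_ge hP subset_union_left))

namespace Mesh

variable {Ω : Set Plane} {T : Mesh Ω} {γ₁ γ₂ : ℝ}

/-- Only boundedly many elements contain a given point: each of them contains a disk of a common
small radius near the point, and these disks are disjoint. -/
theorem card_elem_le (hγ : 0 < γ₁) (hT : T.StarShaped γ₁) (x : Plane) :
    (Nat.card {a // x ∈ (T.elem a).carrier} : ℝ) ≤ (1 + 1 / γ₁) ^ 2 := by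
  classical
  choose c hc using fun a => (hT a).exists_center
  have hρ : ∀ a, 0 < γ₁ * (T.elem a).diam := fun a => mul_pos hγ (T.elem a).diam_pos
  obtain ⟨δ, hδ, hle⟩ : ∃ δ : ℝ, 0 < δ ∧ ∀ a, δ ≤ γ₁ * (T.elem a).diam := by
    rcases isEmpty_or_nonempty (Fin T.num) with h | h
    · exact ⟨1, one_pos, fun a => h.elim a⟩
    · obtain ⟨a₀, ha₀⟩ := Finite.exists_min fun a => γ₁ * (T.elem a).diam
      exact ⟨_, hρ a₀, ha₀⟩
  let t : Fin T.num → ℝ := fun a => δ / (γ₁ * (T.elem a).diam)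
  have htρ : ∀ a, t a * (γ₁ * (T.elem a).diam) = δ := fun a => div_mul_cancel₀ _ (hρ a).ne'
  have hin : ∀ a, x ∈ (T.elem a).carrier →
      Metric.ball (x + t a • (c a - x)) δ ⊆ interior (T.elem a).carrier := by
    intro a ha
    have := SimplePolygon.homothety_ball_subset_interior (hc a) ha (div_pos hδ (hρ a))
      ((div_le_one (hρ a)).2 (hle a))
    rwa [htρ a] at this
  have key := card_mul_sq_le_of_pairwise_disjoint_ball
    (ι := {a // x ∈ (T.elem a).carrier}) (fun a => x + t a.1 • (c a.1 - x)) x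
    (δ := δ) (R := δ * (1 + 1 / γ₁)) hδ.le (by positivity)
    (fun a b hab => (T.disjoint_elem a b (fun h => hab (Subtype.ext h))).mono
      (hin a a.2) (hin b b.2))
    (fun a => Metric.ball_subset_ball' (by
      have h1 : dist (c a.1) x ≤ (T.elem a).diam :=
        (T.elem a).dist_le_diam (SimplePolygon.ball_subset_of_starConvex (hc a)
          (Metric.mem_ball_self (hρ a))) a.2
      rw [dist_eq_norm, add_sub_cancel_left, norm_smul, ← dist_eq_norm, Real.norm_eq_abs,
        abs_of_pos (div_pos hδ (hρ a))]
      have h2 : t a.1 * dist (c a.1) x ≤ t a.1 * (T.elem a).diam :=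
        mul_le_mul_of_nonneg_left h1 (div_pos hδ (hρ a)).le
      have h3 : t a.1 * (T.elem a).diam = δ * (1 / γ₁) := by
        have := (T.elem a).diam_pos
        simp only [t]
        field_simp
      have h4 : t a.1 * dist (c a.1) x ≤ δ * (1 / γ₁) := h2.trans_eq h3
      linarith))
  rw [Nat.card_eq_fintype_card]
  rw [mul_pow, mul_comm] at key
  exact le_of_mul_le_mul_left key (by positivity)

open Classical in
theorem card_sides_le {N₁ N₂ : ℕ}
    (h₁ : ∀ x, Nat.card {a // x ∈ (T.elem a).carrier} ≤ N₁) (h₂ : ∀ a, (T.elem a).numV ≤ N₂)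
    (x : Plane) : (Finset.univ.filter fun s : T.Side => x ∈ T.seg s).card ≤ N₁ * N₂ := by
  have hsub : (Finset.univ.filter fun s : T.Side => x ∈ T.seg s) ⊆
      (Finset.univ.filter fun a => x ∈ (T.elem a).carrier).sigma fun _ => Finset.univ := by
    rintro ⟨a, i⟩ hs
    simp only [Finset.mem_filter, Finset.mem_univ, true_and] at hs
    simp only [Finset.mem_sigma, Finset.mem_filter, Finset.mem_univ, true_and, and_true]
    exact (T.elem a).frontier_subset ((T.elem a).edgeSet_subset_frontier i hs)
  refine (Finset.card_le_card hsub).trans ?_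
  rw [Finset.card_sigma]
  refine (Finset.sum_le_card_nsmul _ _ N₂ fun a _ => by simpa using h₂ a).trans ?_
  rw [smul_eq_mul]
  refine Nat.mul_le_mul_right _ ?_
  rw [← Fintype.card_subtype, ← Nat.card_eq_fintype_card]
  exact h₁ x

open Classical in
/-- An internal edge is determined by the two sides that define it, a boundary edge by its side
and any of its points. -/
theorem card_edges_le {M : ℕ}
    (hM : ∀ x, (Finset.univ.filter fun s : T.Side => x ∈ T.seg s).card ≤ M)
    (F : Finset T.edges) (x : Plane) :
    (F.filter fun e : T.edges => x ∈ (e : Set Plane)).card ≤ M * M + M := by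
  let S := Finset.univ.filter fun s : T.Side => x ∈ T.seg s
  let m : T.Side → Set Plane := fun s => Classical.epsilon fun e => Maximal
    (fun f : Set Plane => (∃ x y, x ≠ y ∧ f = segment ℝ x y) ∧ f ⊆ T.seg s ∩ frontier Ω) e ∧ x ∈ e
  have hsub : (F.filter fun e : T.edges => x ∈ (e : Set Plane)).image Subtype.val ⊆
      (S ×ˢ S).image (fun p => T.seg p.1 ∩ T.seg p.2) ∪ S.image m := by
    intro e he
    obtain ⟨⟨e, hE⟩, heF, rfl⟩ := Finset.mem_image.1 he
    have hx : x ∈ e := (Finset.mem_filter.1 heF).2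
    rcases hE with ⟨s, t, -, rfl, -⟩ | ⟨s, hs⟩
    · exact Finset.mem_union_left _ (Finset.mem_image.2 ⟨(s, t), by simpa [S] using hx, rfl⟩)
    · have hm := Classical.epsilon_spec (p := fun e => Maximal
        (fun f : Set Plane => (∃ x y, x ≠ y ∧ f = segment ℝ x y) ∧
          f ⊆ T.seg s ∩ frontier Ω) e ∧ x ∈ e) ⟨e, hs, hx⟩
      refine Finset.mem_union_right _ (Finset.mem_image.2
        ⟨s, by simpa [S] using (hs.prop.2 hx).1, ?_⟩)
      exact eq_of_maximal_segment ((T.elem s.1).vertex_finRotate_ne s.2) hm.1 hs hm.2 hx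
  rw [← Finset.card_image_of_injective _ Subtype.val_injective]
  refine (Finset.card_le_card hsub).trans ((Finset.card_union_le _ _).trans ?_)
  refine Nat.add_le_add (Finset.card_image_le.trans ?_) (Finset.card_image_le.trans (hM x))
  rw [Finset.card_product]
  exact Nat.mul_le_mul (hM x) (hM x)

theorem measurableSet_seg (s : T.Side) : MeasurableSet (T.seg s) :=
  (isCompact_Icc.image AffineMap.lineMap_continuous).measurableSet

theorem measurableSet_edge (e : T.edges) : MeasurableSet (e : Set Plane) := by
  rcases e.2 with ⟨s, t, -, h, -⟩ | ⟨s, h⟩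
  · rw [h]; exact (measurableSet_seg s).inter (measurableSet_seg t)
  · obtain ⟨⟨x, y, -, hxy⟩, -⟩ := h.prop
    rw [hxy, ← affineSegment_eq_segment]
    exact (isCompact_Icc.image AffineMap.lineMap_continuous).measurableSet

open Classical in
/-- The edges on a side overlap boundedly often. -/
theorem tsum_lintegral_edges_le {L : ℕ}
    (hL : ∀ (F : Finset T.edges) x, (F.filter fun e : T.edges => x ∈ (e : Set Plane)).card ≤ L)
    (s : T.Side) {f : Plane → ENNReal} (hf : AEMeasurable f (μH[1].restrict (T.seg s))) :
    ∑' e : T.edges, (if (e : Set Plane) ⊆ T.seg s then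
      ∫⁻ x in (e : Set Plane), f x ∂μH[1] else 0) ≤ L * ∫⁻ x in T.seg s, f x ∂μH[1] := by
  rw [ENNReal.tsum_eq_iSup_sum]
  refine iSup_le fun F => ?_
  calc ∑ e ∈ F, (if (e : Set Plane) ⊆ T.seg s then
        ∫⁻ x in (e : Set Plane), f x ∂μH[1] else 0)
      ≤ ∑ e ∈ F, ∫⁻ x in T.seg s, (e : Set Plane).indicator f x ∂μH[1] := by
        refine Finset.sum_le_sum fun e _ => ?_
        split_ifs with h
        · rw [lintegral_indicator (measurableSet_edge e), Measure.restrict_restrict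
            (measurableSet_edge e), inter_eq_self_of_subset_left h]
        · exact zero_le
    _ = ∫⁻ x in T.seg s, ∑ e ∈ F, (e : Set Plane).indicator f x ∂μH[1] :=
        (lintegral_finsetSum' _ fun e _ => hf.indicator (measurableSet_edge e)).symm
    _ ≤ ∫⁻ x in T.seg s, L * f x ∂μH[1] := by
        refine lintegral_mono fun x => ?_
        simp only [indicator_apply]
        rw [← Finset.sum_filter, Finset.sum_const, nsmul_eq_mul]
        gcongr
        exact hL F x
    _ = _ := lintegral_const_mul' _ _ (ENNReal.natCast_ne_top L)

/-! ### The global projection -/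

variable {w : Plane → ℝ}

theorem proj_ae_eq (w : Plane → ℝ) (a : Fin T.num) :
    T.proj w =ᵐ[(T.elem a).area] (T.elem a).proj w := by
  filter_upwards [(T.elem a).ae_mem_interior] with x hx
  rw [proj, Finset.sum_eq_single a]
  · exact indicator_of_mem hx _
  · intro b _ hb
    exact indicator_of_notMem (fun h => Set.disjoint_left.1 (T.disjoint_elem b a hb) h hx) _
  · simp

theorem proj_mem_H1 (hw : w ∈ T.WDG) : T.proj w ∈ T.H1 := by
  have hH : ∀ a, (T.elem a).MemH1 (T.proj w) := fun a =>
    SimplePolygon.memH1_of_ae_eq_affine (SimplePolygon.isProj_of_mem_W (hw.2 a)).1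
      (T.proj_ae_eq w a)
  refine ⟨?_, hH⟩
  have hsub : Ω ⊆ ⋃ a, (T.elem a).carrier := subset_closure.trans T.iUnion_elem.subset
  refine MemLp.mono_measure (Measure.restrict_mono hsub le_rfl)
    ⟨AEStronglyMeasurable.iUnion fun a => (hH a).1.1, ?_⟩
  refine ((ENNReal.pow_lt_top_iff (n := 2)).1 ?_).resolve_right two_ne_zero
  rw [eLpNorm_two_sq]
  refine (lintegral_iUnion_le _ _).trans_lt ?_
  rw [tsum_fintype, ENNReal.sum_lt_top]
  intro a _
  have h := ENNReal.pow_lt_top (n := 2) (hH a).1.2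
  rwa [eLpNorm_two_sq] at h

/-! ### Jumps -/

open Classical in
/-- The jump of the projection error on an edge, bounded by the one-sided traces. -/
theorem enorm_jump_sq_le {M : ℕ}
    (hM : ∀ x, (Finset.univ.filter fun s : T.Side => x ∈ T.seg s).card ≤ M) (v w : Plane → ℝ)
    {e : Set Plane} {x : Plane} (hx : x ∈ e) :
    ‖T.jump v e x‖ₑ ^ 2 ≤ 2 * ‖T.jump w e x‖ₑ ^ 2 + 2 * (M * ∑ s : T.Side, if e ⊆ T.seg s then
      ‖(T.elem s.1).trace v x - (T.elem s.1).trace w x‖ₑ ^ 2 else 0) := by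
  set d : T.Side → ℝ := fun s => (T.elem s.1).trace v x - (T.elem s.1).trace w x
  set D : Plane := ∑ s : T.Side, if e ⊆ T.seg s then d s • (T.elem s.1).outwardNormal s.2 else 0
  have hD : T.jump v e x = T.jump w e x + D := by
    simp only [jump, D, d]
    rw [← Finset.sum_add_distrib]
    refine Finset.sum_congr rfl fun s _ => ?_
    split_ifs
    · rw [← add_smul]; congr 1; ring
    · simp
  set S := Finset.univ.filter fun s : T.Side => e ⊆ T.seg s
  have hS : S.card ≤ M :=
    (Finset.card_le_card (Finset.monotone_filter_right _ fun s _ h => h hx)).trans (hM x)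
  have hDle : ‖D‖ₑ ≤ ∑ s ∈ S, ‖d s‖ₑ := by
    rw [show D = ∑ s ∈ S, d s • (T.elem s.1).outwardNormal s.2 from (Finset.sum_filter _ _).symm]
    refine (enorm_sum_le _ _).trans (Finset.sum_le_sum fun s _ => ?_)
    rw [enorm_smul]
    refine mul_le_of_le_one_right' ?_
    rw [← ofReal_norm, ENNReal.ofReal_le_one]
    exact SimplePolygon.norm_outwardNormal_le _
  have hDsq : ‖D‖ₑ ^ 2 ≤ M * ∑ s ∈ S, ‖d s‖ₑ ^ 2 := by
    refine (pow_le_pow_left' hDle 2).trans ?_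
    have h := ENNReal.rpow_sum_le_const_mul_sum_rpow S (fun s => ‖d s‖ₑ) one_le_two
    norm_num at h
    refine h.trans ?_
    gcongr
  rw [hD, ← Finset.sum_filter, ← mul_add]
  exact (pow_le_pow_left' (enorm_add_le _ _) 2).trans ((ennreal_add_sq_le _ _).trans (by gcongr))

theorem arc_restrict_le {s : T.Side} {e : Set Plane} (h : e ⊆ T.seg s) :
    (μH[1] : Measure Plane).restrict e ≤ (T.elem s.1).arc :=
  Measure.restrict_mono (h.trans ((T.elem s.1).edgeSet_subset_frontier s.2)) le_rfl

open Classical in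
/-- Comparison of the jumps of two functions, for `M` a bound on the number of sides and `L` one on
the number of edges through a point, and `κ s` a bound for `1 / |e|` over the edges `e` on the
side `s`. -/
theorem jumpSq_le {M L : ℕ}
    (hM : ∀ x, (Finset.univ.filter fun s : T.Side => x ∈ T.seg s).card ≤ M)
    (hL : ∀ (F : Finset T.edges) x, (F.filter fun e : T.edges => x ∈ (e : Set Plane)).card ≤ L)
    {v w : Plane → ℝ} (hv : ∀ a, MemLp ((T.elem a).trace v) 2 (T.elem a).arc)
    (hw : ∀ a, MemLp ((T.elem a).trace w) 2 (T.elem a).arc) (κ : T.Side → ENNReal)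
    (hκ : ∀ (s : T.Side) (e : T.edges), (e : Set Plane) ⊆ T.seg s →
      (μH[1] (e : Set Plane))⁻¹ ≤ κ s) :
    T.jumpSq v ≤ 2 * T.jumpSq w + 2 * M * ∑ s : T.Side, κ s * (L * ∫⁻ x in T.seg s,
      ‖(T.elem s.1).trace v x - (T.elem s.1).trace w x‖ₑ ^ 2 ∂μH[1]) := by
  set f : T.Side → Plane → ENNReal := fun s x =>
    ‖(T.elem s.1).trace v x - (T.elem s.1).trace w x‖ₑ ^ 2
  have hf : ∀ s : T.Side, AEMeasurable (f s) (T.elem s.1).arc := fun s =>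
    ((hv s.1).1.sub (hw s.1).1).enorm.pow_const 2
  have hedge : ∀ e : T.edges, (μH[1] (e : Set Plane))⁻¹ *
      ∫⁻ x in (e : Set Plane), ‖T.jump v e x‖ₑ ^ 2 ∂μH[1] ≤
      2 * ((μH[1] (e : Set Plane))⁻¹ * ∫⁻ x in (e : Set Plane), ‖T.jump w e x‖ₑ ^ 2 ∂μH[1]) +
      2 * M * ∑ s : T.Side, κ s * (if (e : Set Plane) ⊆ T.seg s then
        ∫⁻ x in (e : Set Plane), f s x ∂μH[1] else 0) := by
    intro e
    set l := (μH[1] (e : Set Plane))⁻¹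
    have hm : ∀ s ∈ (Finset.univ : Finset T.Side),
        AEMeasurable (fun x => if (e : Set Plane) ⊆ T.seg s then f s x else 0)
          ((μH[1] : Measure Plane).restrict e) := by
      intro s _
      split_ifs with h
      · exact (hf s).mono_measure (arc_restrict_le h)
      · exact aemeasurable_const
    have hms := Finset.aemeasurable_fun_sum Finset.univ hm
    calc l * ∫⁻ x in (e : Set Plane), ‖T.jump v e x‖ₑ ^ 2 ∂μH[1]
        ≤ l * ∫⁻ x in (e : Set Plane), (2 * ‖T.jump w e x‖ₑ ^ 2 +
          2 * (M * ∑ s : T.Side, if (e : Set Plane) ⊆ T.seg s then f s x else 0)) ∂μH[1] := by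
          refine mul_le_mul_right ?_ _
          exact setLIntegral_mono' (measurableSet_edge e) fun x hx => enorm_jump_sq_le hM v w hx
      _ = 2 * (l * ∫⁻ x in (e : Set Plane), ‖T.jump w e x‖ₑ ^ 2 ∂μH[1]) +
          2 * M * ∑ s : T.Side, l * (if (e : Set Plane) ⊆ T.seg s then
            ∫⁻ x in (e : Set Plane), f s x ∂μH[1] else 0) := by
          rw [lintegral_add_right' _ ((hms.const_mul _).const_mul _),
            lintegral_const_mul' _ _ (by norm_num), lintegral_const_mul' _ _ (by norm_num),
            lintegral_const_mul' _ _ (ENNReal.natCast_ne_top M), lintegral_finsetSum' _ hm,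
            ← Finset.mul_sum]
          have hite : ∀ s : T.Side, (∫⁻ x in (e : Set Plane),
              (if (e : Set Plane) ⊆ T.seg s then f s x else 0) ∂μH[1]) =
              if (e : Set Plane) ⊆ T.seg s then ∫⁻ x in (e : Set Plane), f s x ∂μH[1] else 0 := by
            intro s
            split_ifs <;> simp
          simp only [hite]
          ring
      _ ≤ _ := by
          refine add_le_add le_rfl (mul_le_mul_right (Finset.sum_le_sum fun s _ => ?_) _)
          split_ifs with h
          · gcongr
            exact hκ s e h
          · simp
  calc T.jumpSq v ≤ ∑' e : T.edges, (2 * ((μH[1] (e : Set Plane))⁻¹ *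
        ∫⁻ x in (e : Set Plane), ‖T.jump w e x‖ₑ ^ 2 ∂μH[1]) +
      2 * M * ∑ s : T.Side, κ s * (if (e : Set Plane) ⊆ T.seg s then
        ∫⁻ x in (e : Set Plane), f s x ∂μH[1] else 0)) := ENNReal.tsum_le_tsum hedge
    _ = 2 * T.jumpSq w + 2 * M * ∑ s : T.Side, κ s * ∑' e : T.edges,
        (if (e : Set Plane) ⊆ T.seg s then ∫⁻ x in (e : Set Plane), f s x ∂μH[1] else 0) := by
        rw [ENNReal.tsum_add, ENNReal.tsum_mul_left, ENNReal.tsum_mul_left,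
          Summable.tsum_finsetSum fun _ _ => ENNReal.summable]
        simp only [ENNReal.tsum_mul_left]
        rfl
    _ ≤ _ := by
        gcongr with s
        exact tsum_lintegral_edges_le hL s ((hf s).mono_measure (arc_restrict_le subset_rfl))

/-! ### Stability of the projection -/

theorem inv_length_le {γ : ℝ} (hγ : 0 < γ) (hT : T.VerticesSeparated γ) (s : T.Side) (e : T.edges)
    (h : (e : Set Plane) ⊆ T.seg s) :
    (μH[1] (e : Set Plane))⁻¹ ≤ ENNReal.ofReal (γ * (T.elem s.1).diam)⁻¹ := by
  rw [ENNReal.ofReal_inv_of_pos (mul_pos hγ (T.elem s.1).diam_pos), ENNReal.inv_le_inv]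
  exact (hT s.1).2 e e.2 (h.trans ((T.elem s.1).edgeSet_subset_frontier s.2))

/-- The jumps of the projection.  The factor `h_K⁻¹` that comes from the lengths of the edges and
the factor `h_K` of the trace inequality cancel. -/
theorem jumpSq_proj_le (hγ₁ : 0 < γ₁) (hγ₂ : 0 < γ₂) (hs : T.StarShaped γ₁)
    (hv : T.VerticesSeparated γ₂) (hw : w ∈ T.WDG) {N₁ N₂ : ℕ}
    (h₁ : (1 + 1 / γ₁) ^ 2 ≤ (N₁ : ℝ)) (h₂ : (2 * (1 + γ₂) / γ₂) ^ 2 ≤ (N₂ : ℝ)) :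
    T.jumpSq (T.proj w) ≤ 2 * T.jumpSq w +
      2 * (N₁ * N₂ : ℕ) * (N₂ * ((N₁ * N₂ * (N₁ * N₂) + N₁ * N₂ : ℕ) *
        ENNReal.ofReal (16 * ((12 / γ₁ ^ 2 + 1) / γ₁) / γ₂))) *
      ∑ a, eLpNorm ((T.elem a).weakGrad w) 2 (T.elem a).area ^ 2 := by
  classical
  have hn₁ : ∀ x, Nat.card {a // x ∈ (T.elem a).carrier} ≤ N₁ := fun x => by
    exact_mod_cast (card_elem_le hγ₁ hs x).trans h₁
  have hn₂ : ∀ a, (T.elem a).numV ≤ N₂ := fun a => by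
    exact_mod_cast (SimplePolygon.numV_le hγ₂ (hv a).1).trans h₂
  have hM := card_sides_le hn₁ hn₂
  set M := N₁ * N₂
  set L := M * M + M
  have hL := card_edges_le hM
  set C := 16 * ((12 / γ₁ ^ 2 + 1) / γ₁) with hC
  have hCp : 0 < C := by positivity
  have htp : ∀ a, MemLp ((T.elem a).trace (T.proj w)) 2 (T.elem a).arc := fun a =>
    (SimplePolygon.isTrace_of_ae_eq_affine (SimplePolygon.isProj_of_mem_W (hw.2 a)).1
      (T.proj_ae_eq w a)).trace.2.1
  have htw : ∀ a, MemLp ((T.elem a).trace w) 2 (T.elem a).arc := fun a =>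
    (SimplePolygon.isTrace_trace_of_mem_W (hw.2 a)).2.1
  refine (jumpSq_le hM hL htp htw _ (inv_length_le hγ₂ hv)).trans ?_
  rw [mul_assoc (2 * (M : ENNReal))]
  gcongr
  rw [Fintype.sum_sigma, Finset.mul_sum]
  refine Finset.sum_le_sum fun a _ => ?_
  set E := eLpNorm ((T.elem a).weakGrad w) 2 (T.elem a).area ^ 2
  have hside : ∀ i : Fin (T.elem a).numV,
      ENNReal.ofReal (γ₂ * (T.elem a).diam)⁻¹ * (L * ∫⁻ x in T.seg ⟨a, i⟩,
        ‖(T.elem a).trace (T.proj w) x - (T.elem a).trace w x‖ₑ ^ 2 ∂μH[1]) ≤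
      L * ENNReal.ofReal (C / γ₂) * E := by
    intro i
    have hD := (T.elem a).diam_pos
    calc _ ≤ ENNReal.ofReal (γ₂ * (T.elem a).diam)⁻¹ *
          (L * (ENNReal.ofReal (C * (T.elem a).diam) * E)) := by
          gcongr
          exact SimplePolygon.lintegral_side_trace_sub_le hγ₁ (hs a) (hw.2 a) (T.proj_ae_eq w a) i
      _ = _ := by
          rw [show C / γ₂ = (γ₂ * (T.elem a).diam)⁻¹ * (C * (T.elem a).diam) by field_simp,
            ENNReal.ofReal_mul (p := (γ₂ * (T.elem a).diam)⁻¹) (by positivity)]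
          ring
  refine (Finset.sum_le_sum fun i _ => hside i).trans ?_
  rw [Finset.sum_const, Finset.card_univ, Fintype.card_fin, nsmul_eq_mul, mul_assoc (N₂ : ENNReal)]
  gcongr
  exact hn₂ a

end Mesh
end DVEM

theorem lemma7 (Khat : DVEM.SimplePolygon) (γ₁ γ₂ : ℝ) (hγ₁ : 0 < γ₁) (hγ₂ : 0 < γ₂) :
    ∃ c : NNReal, ∀ (Ω : Set DVEM.Plane), IsOpen Ω → IsConnected Ω → Bornology.IsBounded Ω →
      interior (closure Ω) = Ω →
      ∀ T : DVEM.Mesh Ω, T.AffineEquivalentTo Khat → T.StarShaped γ₁ → T.VerticesSeparated γ₂ →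
        ∀ w ∈ T.WDG, T.proj w ∈ T.H1 ∧ T.dgNorm (T.proj w) ≤ (c : ENNReal) * T.dgNorm w := by
  obtain ⟨N₁, h₁⟩ := exists_nat_ge ((1 + 1 / γ₁) ^ 2)
  obtain ⟨N₂, h₂⟩ := exists_nat_ge ((2 * (1 + γ₂) / γ₂) ^ 2)
  let B : NNReal := 2 * (N₁ * N₂ : ℕ) * (N₂ * ((N₁ * N₂ * (N₁ * N₂) + N₁ * N₂ : ℕ) *
    Real.toNNReal (16 * ((12 / γ₁ ^ 2 + 1) / γ₁) / γ₂)))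
  refine ⟨(2 + B) ^ (1 / 2 : ℝ), fun Ω _ _ _ _ T _ hs hv w hw => ⟨T.proj_mem_H1 hw, ?_⟩⟩
  have hJ : T.jumpSq (T.proj w) ≤ 2 * T.jumpSq w +
      (B : ENNReal) * ∑ a, eLpNorm ((T.elem a).weakGrad w) 2 (T.elem a).area ^ 2 := by
    refine (DVEM.Mesh.jumpSq_proj_le hγ₁ hγ₂ hs hv hw h₁ h₂).trans_eq ?_
    simp only [B, ENNReal.ofReal]
    push_cast
    rfl
  rw [DVEM.Mesh.dgNorm, DVEM.Mesh.dgNorm, ENNReal.coe_rpow_of_nonneg _ (by norm_num),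
    ← ENNReal.mul_rpow_of_nonneg _ _ (by norm_num)]
  refine ENNReal.rpow_le_rpow ?_ (by norm_num)
  have hG : ∀ a, eLpNorm ((T.elem a).weakGrad (T.proj w)) 2 (T.elem a).area ≤
      eLpNorm ((T.elem a).weakGrad w) 2 (T.elem a).area := fun a =>
    DVEM.SimplePolygon.eLpNorm_weakGrad_le (hw.2 a) (T.proj_ae_eq w a)
  have hv : ∀ a, eLpNorm (T.proj w) 2 (T.elem a).area ≤ eLpNorm w 2 (T.elem a).area := fun a => by
    rw [eLpNorm_congr_ae (T.proj_ae_eq w a)]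
    exact DVEM.SimplePolygon.eLpNorm_proj_le (hw.2 a)
      (DVEM.SimplePolygon.isProj_of_mem_W (hw.2 a)).1
  set X := ∑ a, (eLpNorm ((T.elem a).weakGrad w) 2 (T.elem a).area ^ 2 +
    eLpNorm w 2 (T.elem a).area ^ 2) with hX
  have hle : ∑ a, eLpNorm ((T.elem a).weakGrad w) 2 (T.elem a).area ^ 2 ≤ X :=
    Finset.sum_le_sum fun a _ => le_self_add
  calc _ ≤ X + (2 * T.jumpSq w + B * X) := by
        refine add_le_add (Finset.sum_le_sum fun a _ => ?_) (hJ.trans (by gcongr))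
        gcongr
        · exact hG a
        · exact hv a
    _ ≤ X + (2 * T.jumpSq w + B * X) + (X + B * T.jumpSq w) := le_self_add
    _ = _ := by
        push_cast
        ring
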